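/- Let $A\in GL_k(\mathbb{Z})$ induce a linear Anosov diffeomorphism of $\mathbb{T}^k=\mathbb{R}^k/\mathbb{Z}^k$ with $k$ distinct real eigenvalues $B_1,\dots,B_k$ (none of modulus $1$) and a basis $v_1,\dots,v_k$ of $\mathbb{R}^k$ of corresponding eigenvectors. Let $0<\lambda<1$, $p:\mathbb{T}^k\to\mathbb{R}$, $\underline t\in\mathbb{T}^k$, and let $i$ be such that $|B_i|<\lambda$. Put $$q_i(t)=p(tv_i+\underline t),\qquad \phi_i(t)=\sum_{n=0}^{\infty}\lambda^n q_i(B_i^{-n}t),\qquad \alpha=\frac{\ln\lambda}{\ln|B_i|}\in(0,1).$$ A function $q:\mathbb{R}\to\mathbb{R}$ is almost periodic if for every $\epsilon>0$ there is $l>0$ such that every interval of length $l$ contains a $\tau$ with $|q(x)-q(x+\tau)|<\epsilon$ for all $x\in\mathbb{R}$; its Fourier coefficients are $q_a=\lim_{T\to\infty}\frac1{2T}\int_{-T}^{T}q(t)e^{-iat}\,dt$, $a\in\mathbb{R}$. It satisfies (H1) if $\sum_{a\in\mathbb{R}}|q_a||a|^{\alpha}<\infty$. Suppose that $q_i$ is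 $C^1$, almost periodic and satisfies (H1). Then the Fourier coefficients $(q_i)_a$ exist, the series defining $\phi_i$ converges, and for every $\sigma\neq0$ the Fourier coefficient $$(g_i)_\sigma=\sum_{n=-\infty}^{\infty}\lambda^n (q_i)_{\sigma B_i^{n}}$$ of the formal series $g_i(t)=\sum_{n=-\infty}^{\infty}\lambda^nq_i(B_i^{-n}t)$ converges. If $A\underline t=\underline t$ in $\mathbb{T}^k$, then $\phi_i(t)=\phi(tv_i+\underline t)$ for all $t$, where $\phi(x)=\sum_{n=0}^\infty\lambda^n p(A^{-n}x)$; that is, $\phi_i$ is the sub-slice at $\underline t$, in the direction $v_i$, of the graph of $\phi$. Moreover, for every base point $\underline t$, exactly one of the following holds: 1. $(g_i)_\sigma=0$ for all $\sigma\ne0$, $\phi_i$ is $C^1$, and the graph of $\phi_i$ over every compact interval $[c,d]$, $c<d$, has box dimension $1$; 2. $(g_i)_\sigma\neq0$ for some $\sigma\neq0$, and the graph of $\phi_i$ over every compact interval $[c,d]$, $c<d$, has box dimension $2-\dfrac{\ln\lambda}{\ln|B_i|}$. Here a non-empty totally bounded set $X$ has box dimension $d$ if $\liminf$ and $\limsup$,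 as $\delta\to0^+$, of $\log N_\delta(X)/(-\log\delta)$ both equal $d$, where $N_\delta(X)$ is the least number of sets of diameter at most $\delta$ whose union covers $X$. -/

import Mathlib

open Filter Topology

noncomputable section

namespace SkewGraph

/-! ### Box dimension -/

/-- `N_δ(X)`: the smallest number of sets of diameter at most `δ` whose union covers `X`. -/
def coverNumber {M : Type*} [PseudoMetricSpace M] (δ : ℝ) (X : Set M) : ℕ :=
  sInf {n : ℕ | ∃ U : Fin n → Set M,
    (∀ j, Bornology.IsBounded (U j) ∧ Metric.diam (U j) ≤ δ) ∧ X ⊆ ⋃ j, U j}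

/-- The lower box dimension. -/
def lowerBoxDim {M : Type*} [PseudoMetricSpace M] (X : Set M) : EReal :=
  liminf (fun δ : ℝ => ((Real.log (coverNumber δ X) / -Real.log δ : ℝ) : EReal)) (𝓝[>] 0)

/-- The upper box dimension. -/
def upperBoxDim {M : Type*} [PseudoMetricSpace M] (X : Set M) : EReal :=
  limsup (fun δ : ℝ => ((Real.log (coverNumber δ X) / -Real.log δ : ℝ) : EReal)) (𝓝[>] 0)

/-- `X` is a non-empty totally bounded set whose lower and upper box dimensions are both `d`. -/
def HasBoxDim {M : Type*} [PseudoMetricSpace M] (X : Set M) (d : ℝ) : Prop :=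
  X.Nonempty ∧ TotallyBounded X ∧ lowerBoxDim X = (d : EReal) ∧ upperBoxDim X = (d : EReal)

/-- The graph of `f` over `[c, d]`, as a subset of the Euclidean plane. -/
def graphOver (f : ℝ → ℝ) (c d : ℝ) : Set (EuclideanSpace ℝ (Fin 2)) :=
  (fun t : ℝ => !₂[t, f t]) '' Set.Icc c d

/-! ### Almost periodic functions and the hypothesis (H1) -/

/-- Almost periodicity in the sense of Bohr. -/
def IsAlmostPeriodic (q : ℝ → ℝ) : Prop :=
  ∀ ε > 0, ∃ l > 0, ∀ c : ℝ, ∃ τ ∈ Set.Icc c (c + l), ∀ x, |q x - q (x + τ)| < ε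

/-- The mean `(1 / 2T) ∫_{-T}^{T} q(t) e^{-iat} dt`. -/
def fourierMean (q : ℝ → ℝ) (a T : ℝ) : ℂ :=
  (1 / (2 * T) : ℂ) * ∫ t in (-T)..T, (q t : ℂ) * Complex.exp (-(Complex.I * a * t))

/-- The Fourier coefficient `q_a`, the limit of the means as `T → ∞`. -/
def fourierCoeffAP (q : ℝ → ℝ) (a : ℝ) : ℂ :=
  limUnder atTop (fourierMean q a)

/-- The hypothesis (H1) for `q` relative to `lam` and the expansion factor `b`:
`∑_a |q_a| |a|^α < ∞` with `α = - log lam / log |b|`. -/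
def HypH1 (lam b : ℝ) (q : ℝ → ℝ) : Prop :=
  Summable (fun a : ℝ => ‖fourierCoeffAP q a‖ * |a| ^ (-Real.log lam / Real.log |b|))

/-- The terms `lam^n q_{σ b^{-n}}`, `n ∈ ℤ`, of the Fourier coefficient at `σ` of the formal series
`g(t) = ∑_{n ∈ ℤ} lam^n q(b^n t)`. -/
def gCoeffTerm (lam b : ℝ) (q : ℝ → ℝ) (σ : ℝ) (n : ℤ) : ℂ :=
  ((lam ^ n : ℝ) : ℂ) * fourierCoeffAP q (σ * b ^ (-n))

/-- The Fourier coefficient `g_σ = ∑_{n ∈ ℤ} lam^n q_{σ b^{-n}}`. -/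
def gCoeff (lam b : ℝ) (q : ℝ → ℝ) (σ : ℝ) : ℂ :=
  ∑' n : ℤ, gCoeffTerm lam b q σ n

/-- The function `t ↦ ∑_{n ≥ 0} lam^n q(b^n t)`. -/
def lacunarySum (lam b : ℝ) (q : ℝ → ℝ) (t : ℝ) : ℝ :=
  ∑' n : ℕ, lam ^ n * q (b ^ n * t)

/-! ### The torus and the skew product -/

/-- The torus `ℝ^k / ℤ^k`. -/
abbrev Torus (k : ℕ) : Type := Fin k → UnitAddCircle

/-- The projection `ℝ^k → ℝ^k / ℤ^k`. -/
def toTorus {k : ℕ} (x : Fin k → ℝ) : Torus k := fun j => (x j : UnitAddCircle)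

/-- The endomorphism of the torus induced by an integer matrix. -/
def toralMap {k : ℕ} (A : Matrix (Fin k) (Fin k) ℤ) (x : Torus k) : Torus k :=
  fun j => ∑ l, A j l • x l

/-- The terms `lam^n p(A^{-n} x)` of the series for `φ(x)`. -/
def phiTerm {k : ℕ} (A : Matrix (Fin k) (Fin k) ℤ) (lam : ℝ) (p : Torus k → ℝ) (x : Torus k)
    (n : ℕ) : ℝ :=
  lam ^ n * p (toralMap (A⁻¹ ^ n) x)

/-- The function `φ(x) = ∑_{n ≥ 0} lam^n p(A^{-n} x)`, whose graph is (up to the change of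
variable `A`) the attractor of `F(x, y) = (A x, lam y + p(x))`. -/
def phi {k : ℕ} (A : Matrix (Fin k) (Fin k) ℤ) (lam : ℝ) (p : Torus k → ℝ) (x : Torus k) : ℝ :=
  ∑' n : ℕ, phiTerm A lam p x n

/-- The restriction `t ↦ h(t w + x)` of a function on the torus to the line through `x` in the
direction `w`. -/
def alongLine {k : ℕ} (h : Torus k → ℝ) (w : Fin k → ℝ) (x : Torus k) (t : ℝ) : ℝ :=
  h (toTorus (t • w) + x)

/-- `A` induces a linear Anosov diffeomorphism of the torus whose matrix has the `k` distinct
real eigenvalues `B j`, with eigenvectors `v j` forming a basis of `ℝ^k`. -/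
structure IsLinearAnosov {k : ℕ} (A : Matrix (Fin k) (Fin k) ℤ) (B : Fin k → ℝ)
    (v : Module.Basis (Fin k) ℝ (Fin k → ℝ)) : Prop where
  isUnit_det : IsUnit A.det
  eigen : ∀ j, (A.map (Int.cast : ℤ → ℝ)).mulVec (v j) = B j • v j
  distinct : Function.Injective B
  hyperbolic : ∀ j, |B j| ≠ 1

end SkewGraph

end

/-! Put `b = B_i⁻¹`, so that `|b| > 1`, `λ|b|^α = 1` and `λ|b| > 1`. The two-sided sum `g(t) = ∑_{n
∈ ℤ} λ^n q(b^n t)` may diverge, but its increments `g(t+s) - g(t)` converge absolutely: the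
increments of `q` are the sums of their Fourier series, so the `n`-th term is at most `∑_a |q_a| λ^n
min(2, |b|^n |as|)`. Since `∑_n λ^n min(2, |b|^n y) = O(y^α)` by scaling, (H1) bounds the total by a
multiple of `|s|^α`. The half `n ≥ 0` is the increment of `φ`, which is therefore `α`-Hölder; the
half `n < 0` is the increment of a `C¹` function because `λ|b| > 1` (`increment_eq`).

The increment is almost periodic in `t`, with coefficients `g_σ (e^{iσs} - 1)`
(`increment_eq_tsum_gCoeff`). If `g_σ = 0` for all `σ ≠ 0`, the increments vanish and `φ` is a
constant minus a `C¹` function. If `g_σ ≠ 0` for some `σ ≠ 0`, the step `s = π/σ` gives an increment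
whose mean absolute value over long intervals is bounded below. The self-similarity `g(bt) = λ⁻¹
g(t)` carries this to small steps: with `δ = |s||b|^(-N)`, the mean oscillation of `φ` over a fixed
interval is at least a constant times `λ^N`, of order `δ^α`, the `C¹` half being negligible. A cover
by `N_δ` sets of diameter `δ` bounds the integrated oscillation by `8δ² N_δ`, whence `N_δ ≥ const ·
δ^(α-2)`; Hölder continuity gives the matching upper bound.

What remains is that the increments of `q` equal their Fourier series, which rests on the uniqueness
theorem `IsNormalAP.eq_zero_of_hasCoeff_zero`. If all coefficients of `f` vanish, the twisted means
of `f` are small uniformly in the frequency, so Parseval on a long circle makes the autocorrelation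
of `f` small in mean square. For `f ≠ 0` this is impossible, because the autocorrelation is large at
`0` and hence near every almost period. -/

/-! ### Almost periodic functions in the sense of Bochner -/

/-- A continuous function whose translates are totally bounded in the uniform distance. -/
structure IsNormalAP (f : ℝ → ℂ) : Prop where
  continuous : Continuous f
  net : ∀ ε > 0, ∃ S : Finset ℝ, ∀ s, ∃ s' ∈ S, ∀ x, ‖f (x + s) - f (x + s')‖ ≤ ε

namespace IsNormalAP

variable {f g : ℝ → ℂ}

/-- The two nets may use unrelated points. For each pair of net points that approximates some common
translate, one such translate is chosen; these finitely many choices form the joint net. This is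
what makes sums and products almost periodic. -/
theorem common_net (hf : IsNormalAP f) (hg : IsNormalAP g) {ε : ℝ} (hε : 0 < ε) :
    ∃ S : Finset ℝ, ∀ s, ∃ s' ∈ S,
      (∀ x, ‖f (x + s) - f (x + s')‖ ≤ ε) ∧ ∀ x, ‖g (x + s) - g (x + s')‖ ≤ ε := by
  classical
  obtain ⟨S₁, h₁⟩ := hf.net (ε / 2) (half_pos hε)
  obtain ⟨S₂, h₂⟩ := hg.net (ε / 2) (half_pos hε)
  let P : ℝ × ℝ → ℝ → Prop := fun z s =>
    (∀ x, ‖f (x + s) - f (x + z.1)‖ ≤ ε / 2) ∧ ∀ x, ‖g (x + s) - g (x + z.2)‖ ≤ ε / 2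
  -- The value `0` is a dummy for pairs approximating no common translate.
  let r : ℝ × ℝ → ℝ := fun z => if h : ∃ s, P z s then h.choose else 0
  refine ⟨(S₁ ×ˢ S₂).image r, fun s => ?_⟩
  obtain ⟨a, ha, hfa⟩ := h₁ s
  obtain ⟨b, hb, hgb⟩ := h₂ s
  have hex : ∃ s, P (a, b) s := ⟨s, hfa, hgb⟩
  have hr : P (a, b) (r (a, b)) := by
    simp only [r, dif_pos hex]
    exact hex.choose_spec
  refine ⟨r (a, b), Finset.mem_image_of_mem _ (Finset.mk_mem_product ha hb), fun x => ?_,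
    fun x => ?_⟩
  · calc _ ≤ ‖f (x + s) - f (x + a)‖ + ‖f (x + r (a, b)) - f (x + a)‖ :=
          by
          simpa only [dist_eq_norm] using
            dist_triangle_right (f (x + s)) (f (x + r (a, b))) (f (x + a))
      _ ≤ ε := by linarith [hfa x, hr.1 x]
  · calc _ ≤ ‖g (x + s) - g (x + b)‖ + ‖g (x + r (a, b)) - g (x + b)‖ :=
          by
          simpa only [dist_eq_norm] using
            dist_triangle_right (g (x + s)) (g (x + r (a, b))) (g (x + b))
      _ ≤ ε := by linarith [hgb x, hr.2 x]

theorem exists_bound (hf : IsNormalAP f) : ∃ C > 0, ∀ x, ‖f x‖ ≤ C := by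
  obtain ⟨S, hS⟩ := hf.net 1 one_pos
  refine ⟨∑ s ∈ S, ‖f s‖ + 1, by positivity, fun x => ?_⟩
  obtain ⟨s', hs', h⟩ := hS x
  have h0 := h 0
  simp only [zero_add] at h0
  have h1 : ‖f s'‖ ≤ ∑ s ∈ S, ‖f s‖ :=
    Finset.single_le_sum (f := fun s => ‖f s‖) (fun _ _ => norm_nonneg _) hs'
  linarith [norm_le_norm_sub_add (f x) (f s')]

/-- This is uniform continuity: the translate of `f` by `x` is uniformly close to one of finitely
many translates, and continuity at finitely many points needs no uniformity. -/
theorem uniformly_small_translate (hf : IsNormalAP f) {ε : ℝ} (hε : 0 < ε) :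
    ∀ᶠ h in 𝓝 (0 : ℝ), ∀ x, ‖f (x + h) - f x‖ ≤ ε := by
  obtain ⟨S, hS⟩ := hf.net (ε / 3) (by positivity)
  have key : ∀ᶠ h in 𝓝 (0 : ℝ), ∀ s ∈ S, ‖f (h + s) - f s‖ < ε / 3 := by
    rw [Finset.eventually_all]
    intro s _
    have hc : Tendsto (fun h : ℝ => ‖f (h + s) - f s‖) (𝓝 0) (𝓝 0) := by
      have : Continuous fun h : ℝ => ‖f (h + s) - f s‖ := by
        have := hf.continuous
        fun_prop
      simpa using this.tendsto 0
    exact hc.eventually (gt_mem_nhds (by positivity))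
  filter_upwards [key] with h hh x
  obtain ⟨s', hs', hx⟩ := hS x
  have h0 := hx 0
  have h1 := hx h
  rw [zero_add, zero_add] at h0
  have h2 := hh s' hs'
  have e : f (x + h) - f x = (f (h + x) - f (h + s')) + (f (h + s') - f s') - (f x - f s') := by
    rw [add_comm x h]; ring
  rw [e]
  refine (norm_sub_le _ _).trans ?_
  linarith [norm_add_le (f (h + x) - f (h + s')) (f (h + s') - f s')]

theorem add (hf : IsNormalAP f) (hg : IsNormalAP g) : IsNormalAP fun t => f t + g t := by
  refine ⟨hf.continuous.add hg.continuous, fun ε hε => ?_⟩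
  obtain ⟨S, hS⟩ := hf.common_net hg (half_pos hε)
  refine ⟨S, fun s => ?_⟩
  obtain ⟨s', hs', h₁, h₂⟩ := hS s
  refine ⟨s', hs', fun x => ?_⟩
  rw [add_sub_add_comm]
  linarith [norm_add_le (f (x + s) - f (x + s')) (g (x + s) - g (x + s')), h₁ x, h₂ x]

theorem mul (hf : IsNormalAP f) (hg : IsNormalAP g) : IsNormalAP fun t => f t * g t := by
  refine ⟨hf.continuous.mul hg.continuous, fun ε hε => ?_⟩
  obtain ⟨C, hC, hfC⟩ := hf.exists_bound
  obtain ⟨D, hD, hgD⟩ := hg.exists_bound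
  obtain ⟨S, hS⟩ := hf.common_net hg (ε := ε / (C + D)) (by positivity)
  refine ⟨S, fun s => ?_⟩
  obtain ⟨s', hs', h₁, h₂⟩ := hS s
  refine ⟨s', hs', fun x => ?_⟩
  have e : f (x + s) * g (x + s) - f (x + s') * g (x + s') =
      f (x + s) * (g (x + s) - g (x + s')) + (f (x + s) - f (x + s')) * g (x + s') := by ring
  rw [e]
  calc _ ≤ ‖f (x + s)‖ * ‖g (x + s) - g (x + s')‖ + ‖f (x + s) - f (x + s')‖ * ‖g (x + s')‖ := by
        simpa only [norm_mul] using norm_add_le (f (x + s) * (g (x + s) - g (x + s')))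
          ((f (x + s) - f (x + s')) * g (x + s'))
    _ ≤ C * (ε / (C + D)) + ε / (C + D) * D := by
        gcongr
        exacts [hfC _, h₂ x, h₁ x, hgD _]
    _ = ε := by field_simp

theorem const (c : ℂ) : IsNormalAP fun _ => c :=
  ⟨continuous_const, fun ε hε => ⟨{0}, fun _ => ⟨0, by simp, fun _ => by simpa using hε.le⟩⟩⟩

theorem comp_add (hf : IsNormalAP f) (a : ℝ) : IsNormalAP fun t => f (t + a) := by
  refine ⟨hf.continuous.comp (continuous_id.add continuous_const), fun ε hε => ?_⟩
  obtain ⟨S, hS⟩ := hf.net ε hε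
  refine ⟨S, fun s => ?_⟩
  obtain ⟨s', hs', h⟩ := hS s
  refine ⟨s', hs', fun x => ?_⟩
  have := h (x + a)
  rwa [add_right_comm x a s, add_right_comm x a s'] at this

theorem conj (hf : IsNormalAP f) : IsNormalAP fun t => starRingEnd ℂ (f t) := by
  refine ⟨Complex.continuous_conj.comp hf.continuous, fun ε hε => ?_⟩
  obtain ⟨S, hS⟩ := hf.net ε hε
  refine ⟨S, fun s => ?_⟩
  obtain ⟨s', hs', h⟩ := hS s
  exact ⟨s', hs', fun x => by rw [← map_sub, RCLike.norm_conj]; exact h x⟩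

theorem of_uniform_approx (h : ∀ ε > 0, ∃ g, IsNormalAP g ∧ ∀ x, ‖f x - g x‖ ≤ ε) :
    IsNormalAP f := by
  constructor
  · rw [Metric.continuous_iff]
    intro x ε hε
    obtain ⟨g, hg, hfg⟩ := h (ε / 4) (by positivity)
    obtain ⟨δ, hδ, hd⟩ := Metric.continuous_iff.1 hg.continuous x (ε / 4) (by positivity)
    refine ⟨δ, hδ, fun y hy => ?_⟩
    have h1 := hd y hy
    rw [dist_eq_norm] at h1 ⊢
    have e : f y - f x = (f y - g y) + (g y - g x) - (f x - g x) := by ring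
    rw [e]
    refine (norm_sub_le _ _).trans_lt ?_
    linarith [norm_add_le (f y - g y) (g y - g x), hfg y, hfg x]
  · intro ε hε
    obtain ⟨g, hg, hfg⟩ := h (ε / 3) (by positivity)
    obtain ⟨S, hS⟩ := hg.net (ε / 3) (by positivity)
    refine ⟨S, fun s => ?_⟩
    obtain ⟨s', hs', h⟩ := hS s
    refine ⟨s', hs', fun x => ?_⟩
    have e : f (x + s) - f (x + s') = (f (x + s) - g (x + s)) + (g (x + s) - g (x + s')) -
      (f (x + s') - g (x + s')) := by ring
    rw [e]
    refine (norm_sub_le _ _).trans ?_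
    linarith [norm_add_le (f (x + s) - g (x + s)) (g (x + s) - g (x + s')), hfg (x + s),
      hfg (x + s'), h x]

theorem finset_sum {ι : Type*} (F : ι → ℝ → ℂ) (s : Finset ι) (h : ∀ j ∈ s, IsNormalAP (F j)) :
    IsNormalAP fun t => ∑ j ∈ s, F j t := by
  classical
  induction s using Finset.induction_on with
  | empty => simpa using const 0
  | insert a s ha ih =>
    simp only [Finset.sum_insert ha]
    exact (h a (Finset.mem_insert_self _ _)).add
      (ih fun j hj => h j (Finset.mem_insert_of_mem hj))

end IsNormalAP

/-- The character `t ↦ e^{iat}` of the real line. -/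
noncomputable def character (a t : ℝ) : ℂ := Complex.exp (Complex.I * a * t)

theorem character_add (a s t : ℝ) : character a (s + t) = character a s * character a t := by
  simp only [character, ← Complex.exp_add]
  congr 1
  push_cast
  ring

theorem character_add_freq (a b t : ℝ) :
    character (a + b) t = character a t * character b t := by
  simp only [character, ← Complex.exp_add]
  congr 1
  push_cast
  ring

theorem character_mul_freq (a b t : ℝ) : character (a * b) t = character a (b * t) := by
  simp only [character]
  congr 1
  push_cast
  ring

@[simp] theorem character_zero_freq (t : ℝ) : character 0 t = 1 := by simp [character]

@[simp] theorem character_zero (a : ℝ) : character a 0 = 1 := by simp [character]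

@[simp] theorem norm_character (a t : ℝ) : ‖character a t‖ = 1 := by
  have : Complex.I * a * t = ((a * t : ℝ) : ℂ) * Complex.I := by push_cast; ring
  rw [character, this, Complex.norm_exp_ofReal_mul_I]

theorem continuous_character (a : ℝ) : Continuous (character a) := by
  unfold character
  fun_prop

theorem norm_character_sub_one_le (a t : ℝ) : ‖character a t - 1‖ ≤ |a * t| := by
  have : Complex.I * a * t = Complex.I * ((a * t : ℝ) : ℂ) := by push_cast; ring
  rw [character, this]
  simpa using Real.norm_exp_I_mul_ofReal_sub_one_le (x := a * t)

theorem isNormalAP_character (a : ℝ) : IsNormalAP (character a) := by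
  refine ⟨continuous_character a, fun ε hε => ?_⟩
  have hb : TotallyBounded (Set.range (character a)) := by
    refine (isCompact_closedBall (0 : ℂ) 1).totallyBounded.subset ?_
    rintro _ ⟨t, rfl⟩
    simp
  obtain ⟨u, hu, hfin, hcov⟩ := Metric.finite_approx_of_totallyBounded hb ε hε
  choose! r hr using fun y (hy : y ∈ u) => hu hy
  classical
  refine ⟨hfin.toFinset.image r, fun s => ?_⟩
  obtain ⟨y, hy⟩ := Set.mem_iUnion.1 (hcov ⟨s, rfl⟩)
  obtain ⟨hyu, hys⟩ := Set.mem_iUnion.1 hy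
  refine ⟨r y, Finset.mem_image_of_mem _ (by simpa using hyu), fun x => ?_⟩
  rw [character_add, character_add, ← mul_sub, norm_mul, norm_character, one_mul, hr y hyu,
    ← dist_eq_norm]
  exact (Metric.mem_ball.1 hys).le

/-- Bohr implies Bochner: an almost period moves any translation parameter into `[0, l]` at small
uniform cost, and there compactness and uniform continuity supply a finite net. -/
theorem SkewGraph.IsAlmostPeriodic.isNormalAP {q : ℝ → ℝ} (hap : SkewGraph.IsAlmostPeriodic q)
    (hq : Continuous q) : IsNormalAP fun t => (q t : ℂ) := by
  have huc : ∀ ε > 0, ∃ ρ > 0, ∀ x y, |x - y| < ρ → |q x - q y| ≤ ε := by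
    intro ε hε
    obtain ⟨l, hl, hτ⟩ := hap (ε / 3) (by positivity)
    have hu := (isCompact_Icc (a := (-1 : ℝ)) (b := l + 1)).uniformContinuousOn_of_continuous
      hq.continuousOn
    obtain ⟨ρ, hρ, h⟩ := Metric.uniformContinuousOn_iff.1 hu (ε / 3) (by positivity)
    refine ⟨min ρ 1, by positivity, fun x y hxy => ?_⟩
    -- Now `x + τ` lies in `[0, l]`, and `y + τ` in `[-1, l + 1]` since `|x - y| < 1`.
    obtain ⟨τ, ⟨h1, h2⟩, h3⟩ := hτ (-x)
    have hxy1 := abs_lt.1 (hxy.trans_le (min_le_right _ _))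
    have h4 := h (x + τ) ⟨by linarith, by linarith⟩ (y + τ) ⟨by linarith, by linarith⟩ (by
      rw [Real.dist_eq, add_sub_add_right_eq_sub]
      exact hxy.trans_le (min_le_left _ _))
    rw [Real.dist_eq] at h4
    have h5 := abs_lt.1 (h3 x)
    have h6 := abs_lt.1 (h3 y)
    have h7 := abs_lt.1 h4
    rw [abs_le]
    constructor <;> linarith [h5.1, h5.2, h6.1, h6.2, h7.1, h7.2]
  refine ⟨Complex.continuous_ofReal.comp hq, fun ε hε => ?_⟩
  obtain ⟨l, hl, hτ⟩ := hap (ε / 2) (by positivity)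
  obtain ⟨ρ, hρ, hu⟩ := huc (ε / 2) (by positivity)
  obtain ⟨u, -, hfin, hcov⟩ := Metric.finite_approx_of_totallyBounded
    (isCompact_Icc (a := (0 : ℝ)) (b := l)).totallyBounded ρ hρ
  refine ⟨hfin.toFinset, fun s => ?_⟩
  obtain ⟨τ, ⟨h1, h2⟩, h3⟩ := hτ (-s)
  obtain ⟨y, hy⟩ := Set.mem_iUnion.1 (hcov (show s + τ ∈ Set.Icc 0 l from
    ⟨by linarith, by linarith⟩))
  obtain ⟨hyu, hys⟩ := Set.mem_iUnion.1 hy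
  refine ⟨y, by simpa using hyu, fun x => ?_⟩
  rw [← Complex.ofReal_sub, Complex.norm_real, Real.norm_eq_abs]
  have h4 := h3 (x + s)
  have h5 := hu (x + s + τ) (x + y) (by
    rw [Metric.mem_ball, Real.dist_eq] at hys
    have : x + s + τ - (x + y) = s + τ - y := by ring
    rwa [this])
  calc |q (x + s) - q (x + y)| ≤ |q (x + s) - q (x + s + τ)| + |q (x + s + τ) - q (x + y)| :=
        abs_sub_le _ _ _
    _ ≤ ε := by linarith

/-! ### Uniform means -/

/-- The average of `f` over the interval `[x, x + T]`. -/
noncomputable def avg (f : ℝ → ℂ) (x T : ℝ) : ℂ := (T : ℂ)⁻¹ * ∫ u in (0 : ℝ)..T, f (x + u)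

theorem norm_avg_le {f : ℝ → ℂ} {C x T : ℝ} (hT : 0 < T) (h : ∀ u, ‖f u‖ ≤ C) :
    ‖avg f x T‖ ≤ C := by
  have h1 : ‖∫ u in (0 : ℝ)..T, f (x + u)‖ ≤ C * |T - 0| :=
    intervalIntegral.norm_integral_le_of_norm_le_const fun u _ => h _
  rw [sub_zero, abs_of_pos hT] at h1
  rw [avg, norm_mul, norm_inv, Complex.norm_real, Real.norm_eq_abs, abs_of_pos hT,
    inv_mul_le_iff₀ hT, mul_comm T]
  exact h1

theorem intervalIntegrable_translate {f : ℝ → ℂ} (hf : Continuous f) (x a b : ℝ) :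
    IntervalIntegrable (fun u => f (x + u)) MeasureTheory.volume a b :=
  (hf.comp (continuous_const.add continuous_id)).intervalIntegrable _ _

theorem avg_add {f g : ℝ → ℂ} (hf : Continuous f) (hg : Continuous g) (x T : ℝ) :
    avg (fun t => f t + g t) x T = avg f x T + avg g x T := by
  simp only [avg]
  rw [intervalIntegral.integral_add (intervalIntegrable_translate hf _ _ _)
    (intervalIntegrable_translate hg _ _ _), mul_add]

theorem avg_sub {f g : ℝ → ℂ} (hf : Continuous f) (hg : Continuous g) (x T : ℝ) :
    avg (fun t => f t - g t) x T = avg f x T - avg g x T := by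
  simp only [avg]
  rw [intervalIntegral.integral_sub (intervalIntegrable_translate hf _ _ _)
    (intervalIntegrable_translate hg _ _ _), mul_sub]

theorem avg_const_mul (c : ℂ) (f : ℝ → ℂ) (x T : ℝ) :
    avg (fun t => c * f t) x T = c * avg f x T := by
  simp only [avg, intervalIntegral.integral_const_mul]
  ring

theorem avg_const (c : ℂ) {x T : ℝ} (hT : 0 < T) : avg (fun _ => c) x T = c := by
  have : (T : ℂ) ≠ 0 := by exact_mod_cast hT.ne'
  simp [avg, this]

theorem avg_comp_add (f : ℝ → ℂ) (a x T : ℝ) :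
    avg (fun t => f (t + a)) x T = avg f (x + a) T := by
  simp only [avg, add_right_comm x _ a]

/-- The two windows differ only by two end pieces of length `|v|`. -/
theorem norm_avg_translate_sub_le {f : ℝ → ℂ} (hf : Continuous f) {C T : ℝ} (hT : 0 < T)
    (h : ∀ u, ‖f u‖ ≤ C) (x v : ℝ) : ‖avg f (x + v) T - avg f x T‖ ≤ 2 * C * |v| / T := by
  have hi := fun a b => intervalIntegrable_translate hf x a b
  have e : (∫ u in (0 : ℝ)..T, f (x + v + u)) - ∫ u in (0 : ℝ)..T, f (x + u) =
      (∫ u in T..T + v, f (x + u)) - ∫ u in (0 : ℝ)..v, f (x + u) := by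
    have e1 : (∫ u in (0 : ℝ)..T, f (x + v + u)) = ∫ u in v..T + v, f (x + u) := by
      have := intervalIntegral.integral_comp_add_right (a := 0) (b := T) (fun u => f (x + u)) v
      rw [zero_add] at this
      rw [← this]
      congr 1
      ext u
      congr 1
      ring
    rw [e1, ← intervalIntegral.integral_add_adjacent_intervals (hi v T) (hi T (T + v)),
      ← intervalIntegral.integral_add_adjacent_intervals (hi 0 v) (hi v T)]
    ring
  have b1 : ‖∫ u in T..T + v, f (x + u)‖ ≤ C * |T + v - T| :=
    intervalIntegral.norm_integral_le_of_norm_le_const fun u _ => h _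
  have b2 : ‖∫ u in (0 : ℝ)..v, f (x + u)‖ ≤ C * |v - 0| :=
    intervalIntegral.norm_integral_le_of_norm_le_const fun u _ => h _
  rw [add_sub_cancel_left] at b1
  rw [sub_zero] at b2
  rw [avg, avg, ← mul_sub, e, norm_mul, norm_inv, Complex.norm_real, Real.norm_eq_abs,
    abs_of_pos hT, inv_mul_le_iff₀ hT, mul_div_cancel₀ _ hT.ne']
  linarith [norm_sub_le (∫ u in T..T + v, f (x + u)) (∫ u in (0 : ℝ)..v, f (x + u))]

theorem continuous_avg {f : ℝ → ℂ} (hf : Continuous f) (T : ℝ) :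
    Continuous fun x => avg f x T := by
  unfold avg
  refine continuous_const.mul ?_
  exact intervalIntegral.continuous_parametric_intervalIntegral_of_continuous' (by fun_prop) _ _

theorem avg_avg_comm {f : ℝ → ℂ} (hf : Continuous f) (x S T : ℝ) :
    avg (fun t => avg f t S) x T = avg (fun t => avg f t T) x S := by
  have hswap : (∫ u in (0 : ℝ)..T, ∫ v in (0 : ℝ)..S, f (x + u + v)) =
      ∫ v in (0 : ℝ)..S, ∫ u in (0 : ℝ)..T, f (x + v + u) := by
    rw [MeasureTheory.intervalIntegral_intervalIntegral_swap]
    · simp only [add_right_comm x]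
    · have hc : Continuous (Function.uncurry fun u v => f (x + u + v)) := by
        unfold Function.uncurry
        fun_prop
      exact (hc.continuousOn.integrableOn_compact
        (isCompact_uIcc.prod isCompact_uIcc)).mono_set
        (Set.prod_mono Set.uIoc_subset_uIcc Set.uIoc_subset_uIcc)
  simp only [avg, intervalIntegral.integral_const_mul]
  rw [hswap]
  ring

/-- The average over long intervals tends to `m`, uniformly in the position of the interval. -/
def HasUniformMean (f : ℝ → ℂ) (m : ℂ) : Prop :=
  ∀ ε > 0, ∃ T₀ > 0, ∀ T ≥ T₀, ∀ x, ‖avg f x T - m‖ ≤ ε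

/-- The double average at scales `S` and `T` does not depend on the order of averaging, and it is
close to each single average as soon as that one hardly depends on position. -/
theorem norm_avg_sub_avg_le {f : ℝ → ℂ} (hf : Continuous f) {S T ε ε' : ℝ} (hS : 0 < S)
    (hT : 0 < T) (h : ∀ x y, ‖avg f x S - avg f y S‖ ≤ ε)
    (h' : ∀ x y, ‖avg f x T - avg f y T‖ ≤ ε') (x : ℝ) :
    ‖avg f x S - avg f x T‖ ≤ ε + ε' := by
  have key : ∀ {S T ε : ℝ}, 0 < T → (∀ x y, ‖avg f x S - avg f y S‖ ≤ ε) →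
      ‖avg (fun t => avg f t S) x T - avg f x S‖ ≤ ε := by
    intro S T ε hT h
    rw [← avg_const (avg f x S) (x := x) hT, ← avg_sub (continuous_avg hf S) continuous_const]
    exact norm_avg_le hT fun t => h _ _
  have h1 := key hT h
  have h2 := key hS h'
  rw [avg_avg_comm hf] at h2
  rw [norm_sub_rev] at h1
  exact (norm_sub_le_norm_sub_add_norm_sub _ _ _).trans (add_le_add h1 h2)

/-- A window at `x` may be replaced by one at a net point. The net points are bounded, so for large
`T` their windows almost coincide with the window at `0`. -/
theorem IsNormalAP.norm_avg_sub_le {f : ℝ → ℂ} (hf : IsNormalAP f) {ε : ℝ} (hε : 0 < ε) :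
    ∃ T₀ > 0, ∀ T ≥ T₀, ∀ x y, ‖avg f x T - avg f y T‖ ≤ ε := by
  obtain ⟨C, hC, hfC⟩ := hf.exists_bound
  obtain ⟨S, hS⟩ := hf.net (ε / 4) (by positivity)
  have hD : 0 < ∑ s ∈ S, |s| + 1 := by positivity
  refine ⟨4 * (2 * C * (∑ s ∈ S, |s| + 1)) / ε, by positivity, fun T hT => ?_⟩
  have hT0 : 0 < T := lt_of_lt_of_le (by positivity) hT
  have key : ∀ x, ‖avg f x T - avg f 0 T‖ ≤ ε / 2 := by
    intro x
    obtain ⟨s', hs', h⟩ := hS x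
    have h1 : ‖avg f x T - avg f s' T‖ ≤ ε / 4 := by
      have e : avg f x T - avg f s' T = avg (fun t => f (t + x) - f (t + s')) 0 T := by
        rw [avg_sub (f := fun t => f (t + x)) (g := fun t => f (t + s')) (hf.comp_add x).continuous
          (hf.comp_add s').continuous, avg_comp_add, avg_comp_add, zero_add, zero_add]
      rw [e]
      exact norm_avg_le hT0 h
    have h2 : ‖avg f s' T - avg f 0 T‖ ≤ ε / 4 := by
      have := norm_avg_translate_sub_le hf.continuous hT0 hfC 0 s'
      rw [zero_add] at this
      refine this.trans ?_
      have h3 : |s'| ≤ ∑ s ∈ S, |s| + 1 := by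
        have := Finset.single_le_sum (f := fun s => |s|) (fun _ _ => abs_nonneg _) hs'
        linarith
      have h4 : 4 * (2 * C * (∑ s ∈ S, |s| + 1)) ≤ T * ε := (div_le_iff₀ hε).1 hT
      rw [div_le_iff₀ hT0]
      have : 2 * C * |s'| ≤ 2 * C * (∑ s ∈ S, |s| + 1) := by gcongr
      linarith
    linarith [norm_sub_le_norm_sub_add_norm_sub (avg f x T) (avg f s' T) (avg f 0 T)]
  intro x y
  have h1 := key x
  have h2 := key y
  rw [norm_sub_rev] at h2
  linarith [norm_sub_le_norm_sub_add_norm_sub (avg f x T) (avg f 0 T) (avg f y T)]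

theorem IsNormalAP.exists_hasUniformMean {f : ℝ → ℂ} (hf : IsNormalAP f) :
    ∃ m, HasUniformMean f m := by
  have key : ∀ ε > 0, ∃ T₀ > 0, ∀ T ≥ T₀, ∀ T' ≥ T₀, ∀ x y,
      ‖avg f x T - avg f y T'‖ ≤ ε := by
    intro ε hε
    obtain ⟨T₀, h0, h⟩ := hf.norm_avg_sub_le (show 0 < ε / 3 by positivity)
    refine ⟨T₀, h0, fun T hT T' hT' x y => ?_⟩
    have h1 := norm_avg_sub_avg_le hf.continuous (h0.trans_le hT) (h0.trans_le hT')
      (h T hT) (h T' hT') x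
    have h2 := h T' hT' x y
    linarith [norm_sub_le_norm_sub_add_norm_sub (avg f x T) (avg f x T') (avg f y T')]
  have hc : Cauchy (map (fun T => avg f 0 T) atTop) := by
    rw [Metric.cauchy_iff]
    refine ⟨inferInstance, fun ε hε => ?_⟩
    obtain ⟨T₀, h0, h⟩ := key (ε / 2) (by positivity)
    refine ⟨(fun T => avg f 0 T) '' Set.Ici T₀, image_mem_map (Ici_mem_atTop T₀), ?_⟩
    rintro _ ⟨T, hT, rfl⟩ _ ⟨T', hT', rfl⟩
    rw [dist_eq_norm]
    linarith [h T hT T' hT' 0 0]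
  obtain ⟨m, hm⟩ := cauchy_iff_exists_le_nhds.1 hc
  refine ⟨m, fun ε hε => ?_⟩
  obtain ⟨T₀, h0, h⟩ := key ε hε
  refine ⟨T₀, h0, fun T hT x => ?_⟩
  have ht : Tendsto (fun T' => ‖avg f x T - avg f 0 T'‖) atTop (𝓝 ‖avg f x T - m‖) :=
    (tendsto_const_nhds.sub hm).norm
  exact le_of_tendsto ht ((eventually_ge_atTop T₀).mono fun T' hT' => h T hT T' hT' x 0)

namespace HasUniformMean

variable {f g : ℝ → ℂ} {m m' : ℂ}

theorem add (hf : Continuous f) (hg : Continuous g) (h : HasUniformMean f m)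
    (h' : HasUniformMean g m') : HasUniformMean (fun t => f t + g t) (m + m') := by
  intro ε hε
  obtain ⟨T, h0, hT⟩ := h (ε / 2) (by positivity)
  obtain ⟨T', _, hT'⟩ := h' (ε / 2) (by positivity)
  refine ⟨max T T', lt_max_of_lt_left h0, fun R hR x => ?_⟩
  rw [avg_add hf hg, add_sub_add_comm]
  linarith [norm_add_le (avg f x R - m) (avg g x R - m'), hT R (le_of_max_le_left hR) x,
    hT' R (le_of_max_le_right hR) x]

theorem const_mul (h : HasUniformMean f m) (c : ℂ) :
    HasUniformMean (fun t => c * f t) (c * m) := by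
  intro ε hε
  obtain ⟨T, h0, hT⟩ := h (ε / (‖c‖ + 1)) (by positivity)
  refine ⟨T, h0, fun R hR x => ?_⟩
  rw [avg_const_mul, ← mul_sub, norm_mul]
  calc _ ≤ (‖c‖ + 1) * (ε / (‖c‖ + 1)) := by
        gcongr
        · linarith
        · exact hT R hR x
    _ = ε := by field_simp

theorem comp_add (h : HasUniformMean f m) (a : ℝ) : HasUniformMean (fun t => f (t + a)) m := by
  intro ε hε
  obtain ⟨T, h0, hT⟩ := h ε hε
  exact ⟨T, h0, fun R hR x => by rw [avg_comp_add]; exact hT R hR _⟩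

theorem const (c : ℂ) : HasUniformMean (fun _ => c) c := fun ε hε =>
  ⟨1, one_pos, fun T hT x => by
    rw [avg_const c (one_pos.trans_le hT), sub_self, norm_zero]
    exact hε.le⟩

theorem sub (hf : Continuous f) (hg : Continuous g) (h : HasUniformMean f m)
    (h' : HasUniformMean g m') : HasUniformMean (fun t => f t - g t) (m - m') := by
  simpa [sub_eq_add_neg] using h.add hf (hg.const_smul (-1 : ℂ)) (h'.const_mul (-1))

theorem of_uniform_approx (hf : Continuous f) (h : ∀ ε > 0, ∃ g m', Continuous g ∧
    HasUniformMean g m' ∧ (∀ x, ‖f x - g x‖ ≤ ε) ∧ ‖m - m'‖ ≤ ε) : HasUniformMean f m := by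
  intro ε hε
  obtain ⟨g, m', hg, hm, hfg, hmm⟩ := h (ε / 3) (by positivity)
  obtain ⟨T, h0, hT⟩ := hm (ε / 3) (by positivity)
  refine ⟨T, h0, fun R hR x => ?_⟩
  have h1 : ‖avg f x R - avg g x R‖ ≤ ε / 3 := by
    rw [← avg_sub hf hg]
    exact norm_avg_le (h0.trans_le hR) hfg
  have h2 := hT R hR x
  rw [norm_sub_rev] at hmm
  linarith [norm_sub_le_norm_sub_add_norm_sub (avg f x R) (avg g x R) m,
    norm_sub_le_norm_sub_add_norm_sub (avg g x R) m' m]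

end HasUniformMean

theorem hasUniformMean_character {a : ℝ} (ha : a ≠ 0) : HasUniformMean (character a) 0 := by
  intro ε hε
  have ha' : 0 < |a| := abs_pos.2 ha
  refine ⟨2 / (|a| * ε), by positivity, fun T hT x => ?_⟩
  have hT0 : 0 < T := lt_of_lt_of_le (by positivity) hT
  have hne : Complex.I * (a : ℂ) ≠ 0 := mul_ne_zero Complex.I_ne_zero (by exact_mod_cast ha)
  have e : (∫ u in (0 : ℝ)..T, character a (x + u)) =
      character a x * ((character a T - 1) / (Complex.I * a)) := by
    simp only [character_add, intervalIntegral.integral_const_mul]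
    congr 1
    have := integral_exp_mul_complex (a := 0) (b := T) hne
    simpa [character] using this
  rw [sub_zero, avg, e, norm_mul, norm_mul, norm_character, one_mul, norm_inv, norm_div, norm_mul,
    Complex.norm_I, one_mul, Complex.norm_real, Complex.norm_real, Real.norm_eq_abs,
    Real.norm_eq_abs, abs_of_pos hT0, inv_mul_le_iff₀ hT0, div_le_iff₀ ha']
  have h1 : ‖character a T - 1‖ ≤ 2 := by
    have := norm_sub_le (character a T) 1
    simp only [norm_character, norm_one] at this
    linarith
  have h2 := (div_le_iff₀ (by positivity)).1 hT
  linarith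

/-! ### Fourier coefficients as uniform means. -/

/-- `c` is the Fourier coefficient of `f` at the frequency `a`, as a uniform mean. -/
def HasCoeff (f : ℝ → ℂ) (a : ℝ) (c : ℂ) : Prop :=
  HasUniformMean (fun t => f t * character (-a) t) c

theorem IsNormalAP.exists_hasCoeff {f : ℝ → ℂ} (hf : IsNormalAP f) (a : ℝ) :
    ∃ c, HasCoeff f a c :=
  (hf.mul (isNormalAP_character (-a))).exists_hasUniformMean

theorem hasCoeff_character (a b : ℝ) [Decidable (b = a)] :
    HasCoeff (character b) a (if b = a then 1 else 0) := by
  have e : (fun t => character b t * character (-a) t) = character (b - a) := by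
    ext t
    rw [sub_eq_add_neg, character_add_freq]
  rw [HasCoeff, e]
  split_ifs with h
  · subst h
    have : character (b - b) = fun _ => 1 := by ext t; simp
    rw [this]
    exact HasUniformMean.const 1
  · exact hasUniformMean_character (sub_ne_zero.2 h)

theorem HasCoeff.comp_add {f : ℝ → ℂ} {a : ℝ} {c : ℂ} (h : HasCoeff f a c) (s : ℝ) :
    HasCoeff (fun t => f (t + s)) a (character a s * c) := by
  have h1 := (HasUniformMean.comp_add h s).const_mul (character a s)
  have e : (fun t => character a s * (f (t + s) * character (-a) (t + s))) =
      fun t => f (t + s) * character (-a) t := by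
    ext t
    have : character a s * character (-a) s = 1 := by
      rw [← character_add_freq, add_neg_cancel, character_zero_freq]
    rw [character_add]
    linear_combination (f (t + s) * character (-a) t) * this
  rwa [e] at h1

theorem HasCoeff.tendsto_fourierMean {q : ℝ → ℝ} {a : ℝ} {c : ℂ}
    (h : HasCoeff (fun t => (q t : ℂ)) a c) :
    Tendsto (SkewGraph.fourierMean q a) atTop (𝓝 c) := by
  rw [Metric.tendsto_atTop]
  intro ε hε
  obtain ⟨T₀, h0, hT⟩ := h (ε / 2) (by positivity)
  refine ⟨T₀, fun T hTT => ?_⟩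
  have h1 := hT (2 * T) (by linarith) (-T)
  have e : avg (fun t => (q t : ℂ) * character (-a) t) (-T) (2 * T) =
      SkewGraph.fourierMean q a T := by
    rw [avg, SkewGraph.fourierMean, intervalIntegral.integral_comp_add_left
      (fun t => (q t : ℂ) * character (-a) t) (-T)]
    congr 1
    · push_cast
      rw [one_div]
    · congr 1
      · ext t
        rw [character]
        congr 2
        push_cast
        ring
      · ring
      · ring
  rw [e] at h1
  rw [dist_eq_norm]
  linarith

/-! ### Convolution on the circle and Parseval's identity -/

section Circle

open MeasureTheory AddCircle ComplexConjugate

variable {L : ℝ} [hL : Fact (0 < L)]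

theorem memLp_of_measurable_of_norm_le {f : AddCircle L → ℂ} {C : ℝ} (hf : Measurable f)
    (hC : ∀ x, ‖f x‖ ≤ C) : MemLp f 2 (haarAddCircle (T := L)) :=
  MemLp.of_bound hf.aestronglyMeasurable C (ae_of_all _ hC)

theorem hasSum_sq_norm_fourierCoeff {f : AddCircle L → ℂ} {C : ℝ} (hf : Measurable f)
    (hC : ∀ x, ‖f x‖ ≤ C) :
    HasSum (fun n => ‖fourierCoeff f n‖ ^ 2) (∫ x, ‖f x‖ ^ 2 ∂haarAddCircle (T := L)) := by
  have h := memLp_of_measurable_of_norm_le hf hC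
  have h1 := hasSum_sq_fourierCoeff h.toLp
  simp only [fourierCoeff_congr_ae h.coeFn_toLp] at h1
  convert h1 using 1
  refine integral_congr_ae ?_
  filter_upwards [h.coeFn_toLp] with x hx
  rw [hx]

/-- The correlation of two functions on the circle. -/
noncomputable def correlation (F G : AddCircle L → ℂ) (x : AddCircle L) : ℂ :=
  ∫ t, F (x + t) * conj (G t) ∂haarAddCircle

theorem measurable_correlation {F G : AddCircle L → ℂ} (hF : Measurable F) (hG : Measurable G) :
    Measurable (correlation F G) := by
  have h : StronglyMeasurable fun z : AddCircle L × AddCircle L => F (z.1 + z.2) * conj (G z.2) := by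
    refine Measurable.stronglyMeasurable ?_
    exact (hF.comp (measurable_fst.add measurable_snd)).mul
      (Complex.continuous_conj.measurable.comp (hG.comp measurable_snd))
  exact (StronglyMeasurable.integral_prod_right' h).measurable

theorem norm_correlation_le {F G : AddCircle L → ℂ} {C D : ℝ}
    (hC : ∀ x, ‖F x‖ ≤ C) (hD : ∀ x, ‖G x‖ ≤ D) (x : AddCircle L) :
    ‖correlation F G x‖ ≤ C * D := by
  have := norm_integral_le_of_norm_le_const (μ := haarAddCircle (T := L))
    (f := fun t => F (x + t) * conj (G t)) (C := C * D) (ae_of_all _ fun t => by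
      rw [norm_mul, RCLike.norm_conj]
      exact mul_le_mul (hC _) (hD _) (norm_nonneg _) ((norm_nonneg _).trans (hC 0)))
  simpa [correlation] using this

/-- Fubini and translation invariance of Haar measure, after writing the character at `x` as its
value at `x + t` times the conjugate of its value at `t`. -/
theorem fourierCoeff_correlation {F G : AddCircle L → ℂ} {C D : ℝ} (hF : Measurable F)
    (hG : Measurable G) (hC : ∀ x, ‖F x‖ ≤ C) (hD : ∀ x, ‖G x‖ ≤ D) (n : ℤ) :
    fourierCoeff (correlation F G) n = fourierCoeff F n * conj (fourierCoeff G n) := by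
  have hint : Integrable (Function.uncurry fun x t : AddCircle L =>
      fourier (-n) x * (F (x + t) * conj (G t)))
      ((haarAddCircle (T := L)).prod (haarAddCircle (T := L))) := by
    refine Integrable.of_bound (C := C * D) (Measurable.aestronglyMeasurable ?_)
      (ae_of_all _ fun z => ?_)
    · exact ((fourier (-n)).continuous.measurable.comp measurable_fst).mul
        ((hF.comp (measurable_fst.add measurable_snd)).mul
        (Complex.continuous_conj.measurable.comp (hG.comp measurable_snd)))
    · simp only [Function.uncurry, norm_mul, RCLike.norm_conj, fourier_apply, Circle.norm_coe,
        one_mul]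
      exact mul_le_mul (hC _) (hD _) (norm_nonneg _) ((norm_nonneg _).trans (hC 0))
  calc fourierCoeff (correlation F G) n
      = ∫ x, ∫ t, fourier (-n) x * (F (x + t) * conj (G t)) ∂haarAddCircle (T := L)
          ∂haarAddCircle (T := L) := by
        simp only [fourierCoeff, correlation, smul_eq_mul, integral_const_mul]
    _ = ∫ t, ∫ x, fourier (-n) x * (F (x + t) * conj (G t)) ∂haarAddCircle (T := L)
          ∂haarAddCircle (T := L) := integral_integral_swap hint
    _ = ∫ t, fourierCoeff F n * conj (fourier (-n) t * G t) ∂haarAddCircle (T := L) := by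
        congr 1
        ext t
        have h1 : ∀ x : AddCircle L, fourier (-n) x * (F (x + t) * conj (G t)) =
            (fourier (-n) (x + t) * F (x + t)) * conj (fourier (-n) t * G t) := by
          intro x
          have h2 : fourier (-n) (x + t) = fourier (-n) x * fourier (-n) t := by
            simp only [fourier_apply, smul_add, toCircle_add, Circle.coe_mul]
          have h3 : fourier (-n) t * conj (fourier (-n) t) = 1 := by
            rw [Complex.mul_conj, Complex.normSq_eq_norm_sq, fourier_apply, Circle.norm_coe]
            simp
          rw [h2, map_mul]
          linear_combination (-(fourier (-n) x * (F (x + t) * conj (G t)))) * h3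
        simp only [h1, integral_mul_const]
        congr 1
        rw [integral_add_right_eq_self (fun x => fourier (-n) x * F x) t]
        simp only [fourierCoeff, smul_eq_mul]
    _ = fourierCoeff F n * conj (fourierCoeff G n) := by
        rw [integral_const_mul, integral_conj]
        simp only [fourierCoeff, smul_eq_mul]

/-- By Parseval the left side is the sum of `|F̂ Ĝ|²`. One factor is bounded by `ε`, the other is
summed by Parseval again. -/
theorem integral_sq_norm_correlation_le {F G : AddCircle L → ℂ} {C D ε : ℝ} (hF : Measurable F)
    (hG : Measurable G) (hC : ∀ x, ‖F x‖ ≤ C) (hD : ∀ x, ‖G x‖ ≤ D)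
    (hε : ∀ n, ‖fourierCoeff F n‖ ≤ ε) :
    ∫ x, ‖correlation F G x‖ ^ 2 ∂haarAddCircle (T := L) ≤ ε ^ 2 * D ^ 2 := by
  have h1 := hasSum_sq_norm_fourierCoeff (measurable_correlation hF hG)
    (norm_correlation_le hC hD)
  have h2 := (hasSum_sq_norm_fourierCoeff hG hD).mul_left (ε ^ 2)
  have h3 : ∫ x, ‖G x‖ ^ 2 ∂haarAddCircle (T := L) ≤ D ^ 2 := by
    have := integral_mono_of_nonneg (μ := haarAddCircle (T := L)) (f := fun x => ‖G x‖ ^ 2)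
      (g := fun _ => D ^ 2) (ae_of_all _ fun x => by positivity) (integrable_const _)
      (ae_of_all _ fun x => by
        have := hD x
        simp only
        gcongr)
    simpa using this
  refine (hasSum_le (fun n => ?_) h1 h2).trans (by gcongr)
  rw [fourierCoeff_correlation hF hG hC hD, norm_mul, RCLike.norm_conj, mul_pow]
  have := hε n
  gcongr

theorem measurable_liftIoc {f : ℝ → ℂ} (hf : Measurable f) (a : ℝ) :
    Measurable (liftIoc L a f) :=
  (hf.comp measurable_subtype_coe).comp (measurableEquivIoc L a).measurable

theorem fourierCoeff_liftIoc_eq_avg (f : ℝ → ℂ) (n : ℤ) :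
    fourierCoeff (liftIoc L 0 f) n =
      avg (fun t => f t * character (-(2 * Real.pi * n / L)) t) 0 L := by
  have hL0 : (L : ℂ) ≠ 0 := by exact_mod_cast hL.out.ne'
  rw [fourierCoeff_liftIoc_eq, fourierCoeffOn_eq_integral, avg]
  simp only [zero_add, sub_zero]
  rw [Complex.real_smul]
  push_cast
  rw [one_div]
  congr 1
  refine intervalIntegral.integral_congr fun x _ => ?_
  simp only [smul_eq_mul, mul_comm (f x)]
  congr 1
  rw [fourier_coe_apply, character]
  congr 1
  push_cast
  rw [zero_add, sub_zero]
  field_simp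

theorem intervalIntegrable_of_measurable_of_norm_le {E : Type*} [NormedAddCommGroup E]
    [MeasurableSpace E] [BorelSpace E] [SecondCountableTopology E] {g : ℝ → E} {C : ℝ}
    (hg : Measurable g) (hC : ∀ x, ‖g x‖ ≤ C) (a b : ℝ) : IntervalIntegrable g volume a b := by
  refine ⟨?_, ?_⟩ <;>
  exact Measure.integrableOn_of_bounded (by simp) hg.aestronglyMeasurable (ae_of_all _ hC)

end Circle

/-- On a circle of length `2T`, with the second factor cut off to `(0, T]`, the sums `x + t` with
`x, t ∈ (0, T]` do not wrap around. The circle correlation is then half the correlation on the line,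
and the constant is `8T = 2² · 2T`. -/
theorem avg_sq_norm_correlation_le {f : ℝ → ℂ} {C T ε : ℝ} (hT : 0 < T) (hf : Continuous f)
    (hC : ∀ x, ‖f x‖ ≤ C)
    (hε : ∀ a : ℝ, ‖avg (fun t => f t * character (-a) t) 0 (2 * T)‖ ≤ ε) :
    ∫ x in (0 : ℝ)..T, ‖avg (fun t => f (x + t) * starRingEnd ℂ (f t)) 0 T‖ ^ 2 ≤
      8 * T * ε ^ 2 * C ^ 2 := by
  have : Fact (0 < 2 * T) := ⟨by positivity⟩
  set F := AddCircle.liftIoc (2 * T) 0 f with hF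
  set G := AddCircle.liftIoc (2 * T) 0 ((Set.Ioc 0 T).indicator f) with hG
  have hFm : Measurable F := measurable_liftIoc hf.measurable 0
  have hGm : Measurable G := measurable_liftIoc (hf.measurable.indicator measurableSet_Ioc) 0
  have hFC : ∀ x, ‖F x‖ ≤ C := fun x => hC _
  have hGC : ∀ x, ‖G x‖ ≤ C := fun x => (norm_indicator_le_norm_self _ _).trans (hC _)
  have h1 := integral_sq_norm_correlation_le hFm hGm hFC hGC (ε := ε) fun n => by
    rw [hF, fourierCoeff_liftIoc_eq_avg]
    exact hε _
  have hmk : Measurable fun t : ℝ => (t : AddCircle (2 * T)) :=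
    (AddCircle.continuous_mk' (2 * T)).measurable
  have hint : ∀ (x : AddCircle (2 * T)) (a b : ℝ), IntervalIntegrable
      (fun t : ℝ => F (x + t) * starRingEnd ℂ (G t)) MeasureTheory.volume a b := by
    refine fun x => intervalIntegrable_of_measurable_of_norm_le (C := C * C) ?_ fun t => ?_
    · exact (hFm.comp (hmk.const_add x)).mul
        (Complex.continuous_conj.measurable.comp (hGm.comp hmk))
    · rw [norm_mul, RCLike.norm_conj]
      exact mul_le_mul (hFC _) (hGC _) (norm_nonneg _) ((norm_nonneg _).trans (hC 0))
  have h2 : ∀ x ∈ Set.Ioc 0 T, correlation F G (x : AddCircle (2 * T)) =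
      2⁻¹ * avg (fun t => f (x + t) * starRingEnd ℂ (f t)) 0 T := by
    intro x hx
    rw [correlation, AddCircle.integral_haarAddCircle, ← AddCircle.intervalIntegral_preimage _ 0,
      ← intervalIntegral.integral_add_adjacent_intervals (b := T)]
    rotate_left
    · exact hint _ _ _
    · exact hint _ _ _
    have z : ∫ t in T..0 + 2 * T, F ((x : AddCircle (2 * T)) + (t : AddCircle (2 * T))) *
        starRingEnd ℂ (G (t : AddCircle (2 * T))) = 0 := by
      rw [← intervalIntegral.integral_zero (E := ℂ) (a := T) (b := 0 + 2 * T)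
        (μ := MeasureTheory.volume)]
      refine intervalIntegral.integral_congr_ae (.of_forall fun t ht => ?_)
      rw [Set.uIoc_of_le (by linarith)] at ht
      have : G (t : AddCircle (2 * T)) = 0 := by
        rw [hG, AddCircle.liftIoc_coe_apply ⟨by linarith [ht.1], ht.2⟩, Set.indicator_of_notMem]
        exact fun h => absurd h.2 (not_le.2 ht.1)
      rw [this, map_zero, mul_zero]
    rw [z, add_zero, avg]
    have e : ∫ t in (0 : ℝ)..T, F ((x : AddCircle (2 * T)) + (t : AddCircle (2 * T))) *
        starRingEnd ℂ (G (t : AddCircle (2 * T))) =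
        ∫ t in (0 : ℝ)..T, f (x + t) * starRingEnd ℂ (f t) := by
      refine intervalIntegral.integral_congr_ae (.of_forall fun t ht => ?_)
      rw [Set.uIoc_of_le hT.le] at ht
      have g1 : G (t : AddCircle (2 * T)) = f t := by
        rw [hG, AddCircle.liftIoc_coe_apply ⟨by linarith [ht.1], by linarith [ht.2]⟩,
          Set.indicator_of_mem ht]
      have g2 : F ((x : AddCircle (2 * T)) + (t : AddCircle (2 * T))) = f (x + t) := by
        rw [← AddCircle.coe_add, hF,
          AddCircle.liftIoc_coe_apply ⟨by linarith [ht.1, hx.1], by linarith [ht.2, hx.2]⟩]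
      rw [g1, g2]
    rw [e, Complex.real_smul]
    simp only [zero_add]
    push_cast
    rw [mul_inv, mul_assoc]
  have h3 : ∫ x in (0 : ℝ)..T, ‖avg (fun t => f (x + t) * starRingEnd ℂ (f t)) 0 T‖ ^ 2 =
      4 * ∫ x in (0 : ℝ)..T, ‖correlation F G (x : AddCircle (2 * T))‖ ^ 2 := by
    rw [← intervalIntegral.integral_const_mul]
    refine intervalIntegral.integral_congr_ae (.of_forall fun x hx => ?_)
    rw [Set.uIoc_of_le hT.le] at hx
    rw [h2 x hx, norm_mul, mul_pow]
    norm_num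
    ring
  have h4 : ∫ x in (0 : ℝ)..T, ‖correlation F G (x : AddCircle (2 * T))‖ ^ 2 ≤
      ∫ x in (0 : ℝ)..0 + 2 * T, ‖correlation F G (x : AddCircle (2 * T))‖ ^ 2 := by
    refine intervalIntegral.integral_mono_interval le_rfl hT.le (by linarith)
      (.of_forall fun x => by positivity) ?_
    refine intervalIntegrable_of_measurable_of_norm_le (C := (C * C) ^ 2)
      (((measurable_correlation hFm hGm).comp hmk).norm.pow_const 2) (fun x => ?_) _ _
    rw [norm_pow, norm_norm]
    exact pow_le_pow_left₀ (norm_nonneg _)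
      (norm_correlation_le hFC hGC (x : AddCircle (2 * T))) 2
  rw [AddCircle.intervalIntegral_preimage (2 * T) 0 (fun y => ‖correlation F G y‖ ^ 2)] at h4
  rw [AddCircle.integral_haarAddCircle, smul_eq_mul, inv_mul_le_iff₀ (by positivity)] at h1
  rw [h3]
  linarith

/-! ### The uniqueness theorem for Fourier coefficients -/

/-- Smallness at a single scale `S` passes to large `T`: the `T`-average is nearly the `T`-average
of the `S`-averages, up to shifting its window by at most `S`. -/
theorem norm_avg_le_of_norm_avg_le {g : ℝ → ℂ} {C S ε : ℝ} (hg : Continuous g)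
    (hC : ∀ x, ‖g x‖ ≤ C) (hS : 0 < S) (h : ∀ x, ‖avg g x S‖ ≤ ε) {T : ℝ} (hT : 0 < T) (x : ℝ) :
    ‖avg g x T‖ ≤ ε + 2 * C * S / T := by
  have hC0 : 0 ≤ C := (norm_nonneg _).trans (hC 0)
  have h1 : ‖avg (fun t => avg g t S) x T‖ ≤ ε := norm_avg_le hT h
  have h2 : ‖avg (fun t => avg g t T) x S - avg g x T‖ ≤ 2 * C * S / T := by
    have e : avg (fun t => avg g t T) x S - avg g x T =
        (S : ℂ)⁻¹ * ∫ u in (0 : ℝ)..S, (avg g (x + u) T - avg g x T) := by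
      rw [intervalIntegral.integral_sub (intervalIntegrable_translate (continuous_avg hg T) _ _ _)
        (continuous_const.intervalIntegrable _ _), mul_sub]
      exact congrArg _ (avg_const (avg g x T) (x := x) hS).symm
    have b : ‖∫ u in (0 : ℝ)..S, (avg g (x + u) T - avg g x T)‖ ≤ 2 * C * S / T * |S - 0| := by
      refine intervalIntegral.norm_integral_le_of_norm_le_const fun u hu => ?_
      rw [Set.uIoc_of_le hS.le] at hu
      refine (norm_avg_translate_sub_le hg hT hC x u).trans ?_
      rw [abs_of_pos hu.1]
      have := hu.2
      gcongr
    rw [sub_zero, abs_of_pos hS] at b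
    rw [e, norm_mul, norm_inv, Complex.norm_real, Real.norm_eq_abs, abs_of_pos hS,
      inv_mul_le_iff₀ hS]
    linarith
  rw [avg_avg_comm hg] at h1
  rw [norm_sub_rev] at h2
  linarith [norm_le_norm_sub_add (avg g x T) (avg (fun t => avg g t T) x S)]

/-- Over a window of length `S`, a character of frequency `d` varies by at most `|d| S`. -/
theorem norm_avg_mul_character_sub_le {g : ℝ → ℂ} {C S : ℝ} (hg : Continuous g)
    (hC : ∀ x, ‖g x‖ ≤ C) (hS : 0 < S) (d x : ℝ) :
    ‖avg (fun t => character d t * g t) x S - character d x * avg g x S‖ ≤ |d| * S * C := by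
  have hc := continuous_character d
  have e : avg (fun t => character d t * g t) x S - character d x * avg g x S =
      (S : ℂ)⁻¹ * ∫ u in (0 : ℝ)..S, character d x * ((character d u - 1) * g (x + u)) := by
    have : ∀ u, character d x * ((character d u - 1) * g (x + u)) =
        character d (x + u) * g (x + u) - character d x * g (x + u) := by
      intro u
      rw [character_add]
      ring
    simp only [this]
    rw [intervalIntegral.integral_sub, mul_sub, avg, avg, intervalIntegral.integral_const_mul]
    · ring
    · exact Continuous.intervalIntegrable (by fun_prop) _ _
    · exact Continuous.intervalIntegrable (by fun_prop) _ _
  have b : ‖∫ u in (0 : ℝ)..S, character d x * ((character d u - 1) * g (x + u))‖ ≤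
      (|d| * S * C) * |S - 0| := by
    refine intervalIntegral.norm_integral_le_of_norm_le_const fun u hu => ?_
    rw [Set.uIoc_of_le hS.le] at hu
    rw [norm_mul, norm_character, one_mul, norm_mul]
    have h1 := norm_character_sub_one_le d u
    rw [abs_mul, abs_of_pos hu.1] at h1
    have h2 : |d| * u ≤ |d| * S := by
      have := hu.2
      gcongr
    exact mul_le_mul (h1.trans h2) (hC _) (norm_nonneg _) (by positivity)
  rw [sub_zero, abs_of_pos hS] at b
  rw [e, norm_mul, norm_inv, Complex.norm_real, Real.norm_eq_abs, abs_of_pos hS,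
    inv_mul_le_iff₀ hS]
  linarith

theorem norm_mul_character_le {f : ℝ → ℂ} {C : ℝ} (hC : ∀ x, ‖f x‖ ≤ C) (a t : ℝ) :
    ‖f t * character a t‖ ≤ C := by
  rw [norm_mul, norm_character, mul_one]
  exact hC t

/-- The frequency is perturbed at one fixed scale `S`, where this is harmless, and only then is the
bound carried to large `T`. Thus `ρ` does not depend on `T`. -/
theorem IsNormalAP.norm_avg_le_near {f : ℝ → ℂ} (hf : IsNormalAP f) {a₀ : ℝ}
    (h0 : HasCoeff f a₀ 0) {ε : ℝ} (hε : 0 < ε) :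
    ∃ T₀ > 0, ∃ ρ > 0, ∀ a, |a - a₀| < ρ → ∀ T ≥ T₀,
      ‖avg (fun t => f t * character (-a) t) 0 T‖ ≤ ε := by
  obtain ⟨C, hC, hfC⟩ := hf.exists_bound
  obtain ⟨S, hS, h⟩ := h0 (ε / 3) (by positivity)
  refine ⟨2 * C * S / (ε / 3), by positivity, ε / (3 * C * S), by positivity, fun a ha T hT => ?_⟩
  have hT0 : 0 < T := lt_of_lt_of_le (by positivity) hT
  have hg : Continuous fun t => f t * character (-a₀) t :=
    hf.continuous.mul (continuous_character _)
  have e : (fun t => f t * character (-a) t) =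
      fun t => character (a₀ - a) t * (f t * character (-a₀) t) := by
    ext t
    have : -a = (a₀ - a) + -a₀ := by ring
    rw [this, character_add_freq]
    ring
  have h1 : ∀ x, ‖avg (fun t => f t * character (-a) t) x S‖ ≤ 2 * ε / 3 := by
    intro x
    have h2 := norm_avg_mul_character_sub_le hg (norm_mul_character_le hfC _) hS (a₀ - a) x
    rw [← e] at h2
    have h3 := h S le_rfl x
    rw [sub_zero] at h3
    have h4 : |a₀ - a| * S * C ≤ ε / 3 := by
      rw [abs_sub_comm]
      have := (lt_div_iff₀ (by positivity)).1 ha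
      linarith
    have h5 := norm_le_norm_sub_add (avg (fun t => f t * character (-a) t) x S)
      (character (a₀ - a) x * avg (fun t => f t * character (-a₀) t) x S)
    rw [norm_mul, norm_character, one_mul] at h5
    linarith
  have hga : Continuous fun t => f t * character (-a) t :=
    hf.continuous.mul (continuous_character _)
  have h6 := norm_avg_le_of_norm_avg_le hga (norm_mul_character_le hfC _) hS h1 hT0 0
  have h7 : 2 * C * S / T ≤ ε / 3 := by
    rw [div_le_iff₀ hT0]
    rw [ge_iff_le, div_le_iff₀ (by positivity)] at hT
    linarith
  linarith

/-- The Riemann–Lebesgue argument: shifting by the half period `π / a` changes the sign of the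
character but hardly changes `f`, so the mean nearly equals its own negative. -/
theorem IsNormalAP.norm_avg_le_of_large {f : ℝ → ℂ} (hf : IsNormalAP f) {ε : ℝ} (hε : 0 < ε) :
    ∃ T₀ > 0, ∃ Λ > 0, ∀ a, Λ ≤ |a| → ∀ T ≥ T₀,
      ‖avg (fun t => f t * character (-a) t) 0 T‖ ≤ ε := by
  obtain ⟨C, hC, hfC⟩ := hf.exists_bound
  obtain ⟨δ, hδ, h⟩ := Metric.eventually_nhds_iff.1 (hf.uniformly_small_translate hε)
  refine ⟨2 * C * δ / ε, by positivity, 2 * Real.pi / δ, by positivity, fun a ha T hT => ?_⟩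
  have ha0 : 0 < |a| := lt_of_lt_of_le (by positivity) ha
  have ha' : a ≠ 0 := abs_pos.1 ha0
  have hT0 : 0 < T := lt_of_lt_of_le (by positivity) hT
  have hv : |Real.pi / a| < δ := by
    rw [abs_div, abs_of_pos Real.pi_pos, div_lt_iff₀ ha0]
    have := (div_le_iff₀ hδ).1 ha
    linarith [Real.pi_pos]
  have hch : character (-a) (Real.pi / a) = -1 := by
    have h1 : (a : ℂ) ≠ 0 := by exact_mod_cast ha'
    have : Complex.I * ((-a : ℝ) : ℂ) * ((Real.pi / a : ℝ) : ℂ) = -(Real.pi * Complex.I) := by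
      push_cast
      field_simp
    rw [character, this, Complex.exp_neg, Complex.exp_pi_mul_I]
    norm_num
  have hg : Continuous fun t => f t * character (-a) t :=
    hf.continuous.mul (continuous_character _)
  have h2 := norm_avg_translate_sub_le hg hT0 (norm_mul_character_le hfC _) 0 (Real.pi / a)
  have h3 : ‖avg (fun t => f t * character (-a) t) (0 + Real.pi / a) T +
      avg (fun t => f t * character (-a) t) 0 T‖ ≤ ε := by
    rw [← avg_comp_add, ← avg_add (f := fun t => f (t + Real.pi / a) * character (-a) (t + Real.pi / a))
      (hg.comp (continuous_id.add continuous_const)) hg]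
    refine norm_avg_le hT0 fun t => ?_
    have e : f (t + Real.pi / a) * character (-a) (t + Real.pi / a) + f t * character (-a) t =
        -((f (t + Real.pi / a) - f t) * character (-a) t) := by
      rw [character_add, hch]
      ring
    rw [e, norm_neg, norm_mul, norm_character, mul_one]
    exact h (by rwa [Real.dist_eq, sub_zero]) t
  have h4 : 2 * C * |Real.pi / a| / T ≤ ε := by
    rw [div_le_iff₀ hT0]
    rw [ge_iff_le, div_le_iff₀ hε] at hT
    have : 2 * C * |Real.pi / a| ≤ 2 * C * δ := by gcongr
    linarith
  have e2 : (2 : ℂ) * avg (fun t => f t * character (-a) t) 0 T =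
      (avg (fun t => f t * character (-a) t) (0 + Real.pi / a) T +
      avg (fun t => f t * character (-a) t) 0 T) -
      (avg (fun t => f t * character (-a) t) (0 + Real.pi / a) T -
      avg (fun t => f t * character (-a) t) 0 T) := by ring
  have h5 := (congrArg norm e2).le.trans (norm_sub_le _ _)
  rw [norm_mul] at h5
  norm_num at h5
  rw [zero_add] at h2 h3
  linarith

/-- Large frequencies are covered at once; the remaining compact interval is covered by finitely
many neighbourhoods of fixed frequencies. -/
theorem IsNormalAP.norm_avg_le_uniformly {f : ℝ → ℂ} (hf : IsNormalAP f)
    (h0 : ∀ a, HasCoeff f a 0) {ε : ℝ} (hε : 0 < ε) :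
    ∃ T₀ > 0, ∀ T ≥ T₀, ∀ a, ‖avg (fun t => f t * character (-a) t) 0 T‖ ≤ ε := by
  obtain ⟨T₁, hT₁, Λ, hΛ, hlarge⟩ := hf.norm_avg_le_of_large hε
  choose T₂ hT₂ ρ hρ hnear using fun a => hf.norm_avg_le_near (h0 a) hε
  obtain ⟨t, -, ht⟩ := (isCompact_Icc (a := -Λ) (b := Λ)).elim_nhds_subcover
    (fun a => Metric.ball a (ρ a)) fun a _ => Metric.ball_mem_nhds _ (hρ a)
  have hsum : 0 ≤ ∑ a ∈ t, T₂ a := Finset.sum_nonneg fun a _ => (hT₂ a).le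
  refine ⟨T₁ + ∑ a ∈ t, T₂ a, by linarith, fun T hT a => ?_⟩
  rcases le_or_gt Λ |a| with ha | ha
  · exact hlarge a ha T (by linarith)
  · obtain ⟨b, hb⟩ := Set.mem_iUnion.1 (ht (abs_le.1 ha.le))
    obtain ⟨hbt, hab⟩ := Set.mem_iUnion.1 hb
    have h1 := Finset.single_le_sum (f := T₂) (fun a _ => (hT₂ a).le) hbt
    exact hnear b a (by rwa [Metric.mem_ball, Real.dist_eq] at hab) T (by linarith)

/-- Some translate by a net point brings a value close to `f t₀` near any given point, so a finite
sum of translates of `|f|²` is bounded below everywhere. All these translates have the same uniform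
mean, which therefore cannot be `0`. -/
theorem IsNormalAP.exists_mean_sq_norm_pos {f : ℝ → ℂ} (hf : IsNormalAP f) (hne : f ≠ 0) :
    ∃ m > 0, ∃ T₀ > 0, ∀ T ≥ T₀,
      m ≤ ‖avg (fun t => f (0 + t) * starRingEnd ℂ (f t)) 0 T‖ := by
  obtain ⟨t₀, ht₀⟩ := Function.ne_iff.1 hne
  have hη : 0 < ‖f t₀‖ := norm_pos_iff.2 ht₀
  obtain ⟨S, hS⟩ := hf.net (‖f t₀‖ / 2) (by positivity)
  have hap : IsNormalAP fun t => f t * starRingEnd ℂ (f t) := hf.mul hf.conj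
  obtain ⟨m, hm⟩ := hap.exists_hasUniformMean
  have hlow : ∀ t, (‖f t₀‖ / 2) ^ 2 ≤ ∑ s ∈ S, ‖f (t + s)‖ ^ 2 := by
    intro t
    obtain ⟨s', hs', h⟩ := hS (t₀ - t)
    have h1 := h t
    rw [add_sub_cancel] at h1
    have h2 : ‖f t₀‖ / 2 ≤ ‖f (t + s')‖ := by
      linarith [norm_le_norm_sub_add (f t₀) (f (t + s'))]
    calc (‖f t₀‖ / 2) ^ 2 ≤ ‖f (t + s')‖ ^ 2 := by gcongr
      _ ≤ _ := Finset.single_le_sum (f := fun s => ‖f (t + s)‖ ^ 2)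
        (fun _ _ => by positivity) hs'
  have hreal : ∀ x T, avg (fun t => f t * starRingEnd ℂ (f t)) x T =
      ((T⁻¹ * ∫ u in (0 : ℝ)..T, ‖f (x + u)‖ ^ 2 : ℝ) : ℂ) := by
    intro x T
    rw [avg]
    push_cast
    congr 1
    rw [← intervalIntegral.integral_ofReal]
    congr 1
    ext u
    rw [Complex.mul_conj, Complex.normSq_eq_norm_sq]
  have hmne : m ≠ 0 := by
    rintro rfl
    have hc : (0 : ℝ) < S.card + 1 := by positivity
    obtain ⟨T, hT, hTm⟩ := hm ((‖f t₀‖ / 2) ^ 2 / (2 * (S.card + 1))) (by positivity)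
    have h1 : ∀ s ∈ S, T⁻¹ * ∫ u in (0 : ℝ)..T, ‖f (s + u)‖ ^ 2 ≤
        (‖f t₀‖ / 2) ^ 2 / (2 * (S.card + 1)) := by
      intro s _
      have := hTm T le_rfl s
      rw [sub_zero, hreal, Complex.norm_real, Real.norm_eq_abs] at this
      exact (le_abs_self _).trans this
    have h2 := Finset.sum_le_sum h1
    rw [← Finset.mul_sum, ← intervalIntegral.integral_finsetSum, Finset.sum_const,
      nsmul_eq_mul] at h2
    swap
    · intro s _
      have := hf.continuous
      exact Continuous.intervalIntegrable (by fun_prop) _ _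
    have h3 : (‖f t₀‖ / 2) ^ 2 ≤ T⁻¹ * ∫ u in (0 : ℝ)..T, ∑ s ∈ S, ‖f (s + u)‖ ^ 2 := by
      rw [← div_eq_inv_mul, le_div_iff₀ hT]
      have h4 : ∫ u in (0 : ℝ)..T, (‖f t₀‖ / 2) ^ 2 ≤
          ∫ u in (0 : ℝ)..T, ∑ s ∈ S, ‖f (s + u)‖ ^ 2 := by
        refine intervalIntegral.integral_mono_on hT.le (by simp) ?_ fun u _ => ?_
        · have := hf.continuous
          exact Continuous.intervalIntegrable (by fun_prop) _ _
        · simpa only [add_comm u] using hlow u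
      rw [intervalIntegral.integral_const, sub_zero, smul_eq_mul] at h4
      linarith
    have h5 : (S.card : ℝ) * ((‖f t₀‖ / 2) ^ 2 / (2 * (S.card + 1))) < (‖f t₀‖ / 2) ^ 2 := by
      rw [mul_div_assoc', div_lt_iff₀ (by positivity)]
      have : 0 < (‖f t₀‖ / 2) ^ 2 := by positivity
      nlinarith
    linarith
  have hmp : 0 < ‖m‖ := norm_pos_iff.2 hmne
  obtain ⟨T₀, h0, hT⟩ := hm (‖m‖ / 2) (by positivity)
  refine ⟨‖m‖ / 2, by positivity, T₀, h0, fun T hTT => ?_⟩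
  have h1 := hT T hTT 0
  rw [norm_sub_rev] at h1
  simp only [zero_add]
  linarith [norm_le_norm_sub_add m (avg (fun t => f t * starRingEnd ℂ (f t)) 0 T)]

/-- An almost periodic function all of whose Fourier coefficients vanish is zero. -/
theorem IsNormalAP.eq_zero_of_hasCoeff_zero {f : ℝ → ℂ} (hf : IsNormalAP f)
    (h0 : ∀ a, HasCoeff f a 0) : f = 0 := by
  by_contra hne
  obtain ⟨m, hm, T₁, hT₁, hlow⟩ := hf.exists_mean_sq_norm_pos hne
  obtain ⟨C, hC, hfC⟩ := hf.exists_bound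
  obtain ⟨S, hS⟩ := hf.net (m / (2 * C)) (by positivity)
  set R := ∑ s ∈ S, |s| + 1 with hR
  have hR0 : 0 < R := by positivity
  have hSR : ∀ s ∈ S, |s| ≤ R := fun s hs => by
    have := Finset.single_le_sum (f := fun s => |s|) (fun _ _ => abs_nonneg _) hs
    linarith
  set κ : ℝ := S.card + 1 with hκ
  have hκ0 : 0 < κ := by positivity
  obtain ⟨ε, hε, hεs⟩ : ∃ ε > 0, κ * (8 * ε ^ 2 * C ^ 2) ≤ (m / 2) ^ 2 / 4 := by
    refine ⟨m / (16 * C * κ), by positivity, ?_⟩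
    have : κ * (8 * (m / (16 * C * κ)) ^ 2 * C ^ 2) = m ^ 2 / 32 / κ := by
      field_simp
      ring
    rw [this, div_le_iff₀ hκ0]
    have h1 : 1 ≤ κ := by simp [hκ]
    nlinarith [sq_nonneg m, mul_pos hm hm]
  obtain ⟨T₂, hT₂, hup⟩ := hf.norm_avg_le_uniformly h0 hε
  -- The summand `4 * R` ensures that `[R, T - R]` has length at least `T / 2`, while its translates
  -- by net points stay inside `[0, T]`.
  set T := T₁ + T₂ + 4 * R with hTdef
  have hT0 : 0 < T := by positivity
  set K : ℝ → ℂ := fun x => avg (fun t => f (x + t) * starRingEnd ℂ (f t)) 0 T with hK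
  have hup' : ∫ x in (0 : ℝ)..T, ‖K x‖ ^ 2 ≤ 8 * T * ε ^ 2 * C ^ 2 :=
    avg_sq_norm_correlation_le hT0 hf.continuous hfC fun a => hup _ (by linarith) a
  have hcont : Continuous K := by
    simp only [hK]
    unfold avg
    refine continuous_const.mul
      (intervalIntegral.continuous_parametric_intervalIntegral_of_continuous' ?_ _ _)
    have := hf.continuous
    have := Complex.continuous_conj
    fun_prop
  -- If `s'` approximates the translation by `-x`, then `x + s'` is an almost period of `f`, and `K
  -- (x + s')` is close to `K 0`.
  have hlow' : ∀ x, (m / 2) ^ 2 ≤ ∑ s ∈ S, ‖K (x + s)‖ ^ 2 := by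
    intro x
    obtain ⟨s', hs', h⟩ := hS (-x)
    have hcx : ∀ y, Continuous fun t => f (y + t) * starRingEnd ℂ (f t) := fun y => by
      have := hf.continuous
      have := Complex.continuous_conj
      fun_prop
    have h1 : ‖K 0 - K (x + s')‖ ≤ m / 2 := by
      simp only [hK]
      rw [← avg_sub (hcx 0) (hcx (x + s'))]
      refine norm_avg_le hT0 fun t => ?_
      rw [← sub_mul, norm_mul, RCLike.norm_conj]
      have h2 := h (x + t)
      have e1 : x + t + -x = 0 + t := by ring
      have e2 : x + t + s' = x + s' + t := by ring
      rw [e1, e2] at h2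
      calc _ ≤ m / (2 * C) * C := mul_le_mul h2 (hfC t) (norm_nonneg _) (by positivity)
        _ = m / 2 := by field_simp
    have h3 : m ≤ ‖K 0‖ := hlow T (by linarith)
    have h4 : m / 2 ≤ ‖K (x + s')‖ := by
      linarith [norm_le_norm_sub_add (K 0) (K (x + s'))]
    calc (m / 2) ^ 2 ≤ ‖K (x + s')‖ ^ 2 := by gcongr
      _ ≤ _ := Finset.single_le_sum (f := fun s => ‖K (x + s)‖ ^ 2)
        (fun _ _ => by positivity) hs'
  have h1 : ∫ x in R..T - R, (m / 2) ^ 2 ≤ ∫ x in R..T - R, ∑ s ∈ S, ‖K (x + s)‖ ^ 2 :=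
    intervalIntegral.integral_mono_on (by linarith) (by simp)
      (Continuous.intervalIntegrable (by fun_prop) _ _) fun x _ => hlow' x
  rw [intervalIntegral.integral_const, smul_eq_mul, intervalIntegral.integral_finsetSum] at h1
  swap
  · exact fun s _ => Continuous.intervalIntegrable (by fun_prop) _ _
  have h2 : ∀ s ∈ S, ∫ x in R..T - R, ‖K (x + s)‖ ^ 2 ≤ 8 * T * ε ^ 2 * C ^ 2 := by
    intro s hs
    have hs1 := abs_le.1 (hSR s hs)
    refine le_trans ?_ hup'
    rw [intervalIntegral.integral_comp_add_right (fun x => ‖K x‖ ^ 2) s]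
    exact intervalIntegral.integral_mono_interval (by linarith) (by linarith) (by linarith)
      (.of_forall fun x => by positivity) (Continuous.intervalIntegrable (by fun_prop) _ _)
  have h3 := Finset.sum_le_sum h2
  rw [Finset.sum_const, nsmul_eq_mul] at h3
  have h4 : (S.card : ℝ) * (8 * T * ε ^ 2 * C ^ 2) ≤ κ * (8 * T * ε ^ 2 * C ^ 2) := by
    gcongr
    simp [hκ]
  -- The lower bound integrated over `[R, T - R]` is at least `(T / 2) (m / 2)²`, twice this upper
  -- bound.
  have h5 : κ * (8 * T * ε ^ 2 * C ^ 2) ≤ T * ((m / 2) ^ 2 / 4) := by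
    have := mul_le_mul_of_nonneg_left hεs hT0.le
    linarith
  have h6 : T / 2 ≤ T - R - R := by linarith
  have h7 : 0 < (m / 2) ^ 2 := by positivity
  nlinarith

/-! ### Absolutely convergent series of characters -/

section CharacterSeries

variable {c : ℝ → ℂ}

theorem Summable.mul_character (hc : Summable fun a => ‖c a‖) (t : ℝ) :
    Summable fun a => c a * character a t :=
  Summable.of_norm (by simpa only [norm_mul, norm_character, mul_one] using hc)

/-- Keeping `a` in the finite set makes the coefficient at `a` of the partial sum exactly `c a`. -/
theorem Summable.exists_finset_character_approx (hc : Summable fun a => ‖c a‖) {ε : ℝ}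
    (hε : 0 < ε) (a : ℝ) : ∃ s : Finset ℝ, a ∈ s ∧
      ∀ t, ‖(∑' b, c b * character b t) - ∑ b ∈ s, c b * character b t‖ ≤ ε := by
  have h := (tendsto_tsum_compl_atTop_zero fun a => ‖c a‖).eventually (gt_mem_nhds hε)
  obtain ⟨s, hs, has⟩ := (h.and (eventually_ge_atTop {a})).exists
  refine ⟨s, has (Finset.mem_singleton_self a), fun t => ?_⟩
  rw [← (hc.mul_character t).sum_add_tsum_compl (s := s), add_sub_cancel_left]
  have h1 : Summable fun b : ↥((s : Set ℝ)ᶜ) => ‖c b * character b t‖ := by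
    simp only [norm_mul, norm_character, mul_one]
    exact hc.comp_injective (i := fun b : ↥((s : Set ℝ)ᶜ) => (b : ℝ)) Subtype.val_injective
  refine (norm_tsum_le_tsum_norm h1).trans ?_
  simp only [norm_mul, norm_character, mul_one]
  exact hs.le

theorem isNormalAP_tsum_character (hc : Summable fun a => ‖c a‖) :
    IsNormalAP fun t => ∑' a, c a * character a t := by
  refine IsNormalAP.of_uniform_approx fun ε hε => ?_
  obtain ⟨s, -, hs⟩ := hc.exists_finset_character_approx hε 0
  exact ⟨_, IsNormalAP.finset_sum (fun b t => c b * character b t) s fun b _ =>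
    (IsNormalAP.const (c b)).mul (isNormalAP_character b), hs⟩

theorem HasUniformMean.finset_sum {ι : Type*} {F : ι → ℝ → ℂ} {m : ι → ℂ} (s : Finset ι)
    (hF : ∀ j ∈ s, Continuous (F j)) (h : ∀ j ∈ s, HasUniformMean (F j) (m j)) :
    HasUniformMean (fun t => ∑ j ∈ s, F j t) (∑ j ∈ s, m j) := by
  classical
  induction s using Finset.induction_on with
  | empty => simpa using HasUniformMean.const 0
  | insert a s ha ih =>
    simp only [Finset.sum_insert ha]
    refine (h a (Finset.mem_insert_self _ _)).add (hF a (Finset.mem_insert_self _ _)) ?_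
      (ih (fun j hj => hF j (Finset.mem_insert_of_mem hj))
        fun j hj => h j (Finset.mem_insert_of_mem hj))
    exact continuous_finsetSum _ fun j hj => hF j (Finset.mem_insert_of_mem hj)

theorem hasCoeff_tsum_character (hc : Summable fun a => ‖c a‖) (a : ℝ) :
    HasCoeff (fun t => ∑' b, c b * character b t) a (c a) := by
  classical
  refine HasUniformMean.of_uniform_approx
    ((isNormalAP_tsum_character hc).continuous.mul (continuous_character _)) fun ε hε => ?_
  obtain ⟨s, has, hs⟩ := hc.exists_finset_character_approx hε a
  have hcont : ∀ b ∈ s, Continuous fun t => c b * (character b t * character (-a) t) :=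
    fun b _ => continuous_const.mul ((continuous_character _).mul (continuous_character _))
  refine ⟨fun t => ∑ b ∈ s, c b * (character b t * character (-a) t),
    ∑ b ∈ s, c b * if b = a then 1 else 0, continuous_finsetSum _ hcont,
    HasUniformMean.finset_sum s hcont fun b _ =>
      HasUniformMean.const_mul (hasCoeff_character a b) _, fun t => ?_, ?_⟩
  · simp only [← mul_assoc]
    rw [← Finset.sum_mul, ← sub_mul, norm_mul, norm_character, mul_one]
    exact hs t
  · simp [has, hε.le]

theorem norm_character_sub_one_le_min (a s : ℝ) :
    ‖character a s - 1‖ ≤ min 2 |a * s| := by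
  refine le_min ?_ (norm_character_sub_one_le a s)
  have := norm_sub_le (character a s) 1
  simp only [norm_character, norm_one] at this
  linarith

theorem min_two_le_rpow {α y : ℝ} (hα0 : 0 < α) (hα1 : α ≤ 1) (hy : 0 ≤ y) :
    min 2 y ≤ 2 * y ^ α := by
  rcases le_total y 1 with h | h
  · have : y ^ (1 : ℝ) ≤ y ^ α := Real.rpow_le_rpow_of_exponent_ge_of_imp hy h hα1
      fun _ h' => absurd h' one_ne_zero
    rw [Real.rpow_one] at this
    have := Real.rpow_nonneg hy α
    linarith [min_le_right 2 y]
  · have := Real.one_le_rpow h hα0.le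
    linarith [min_le_left 2 y]

/-- The weight `|a|^α` gives no control of `∑ |c_a|` near `a = 0`. The factor `e^{ias} - 1`, at most
`2 |as|^α` in modulus, supplies it; hence the use of increments of `f` in place of `f`. -/
theorem Summable.mul_character_sub_one {α : ℝ} (hα0 : 0 < α) (hα1 : α ≤ 1)
    (hc : Summable fun a => ‖c a‖ * |a| ^ α) (s : ℝ) :
    Summable fun a => ‖c a * (character a s - 1)‖ := by
  refine Summable.of_nonneg_of_le (fun _ => norm_nonneg _) (fun a => ?_)
    (hc.mul_right (2 * |s| ^ α))
  have h1 := (norm_character_sub_one_le_min a s).trans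
    (min_two_le_rpow hα0 hα1 (abs_nonneg (a * s)))
  rw [abs_mul, Real.mul_rpow (abs_nonneg _) (abs_nonneg _)] at h1
  rw [norm_mul]
  calc _ ≤ ‖c a‖ * (2 * (|a| ^ α * |s| ^ α)) := by gcongr
    _ = _ := by ring

/-- The increments of an almost periodic function with `∑ |c_a| |a|^α < ∞` are the sums of their
Fourier series. -/
theorem IsNormalAP.translate_sub_eq_tsum {f : ℝ → ℂ} (hf : IsNormalAP f)
    (hcoeff : ∀ a, HasCoeff f a (c a)) {α : ℝ} (hα0 : 0 < α) (hα1 : α ≤ 1)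
    (hc : Summable fun a => ‖c a‖ * |a| ^ α) (s t : ℝ) :
    f (t + s) - f t = ∑' a, c a * (character a s - 1) * character a t := by
  have hsum := hc.mul_character_sub_one hα0 hα1 s
  set G : ℝ → ℂ := fun t => ∑' a, c a * (character a s - 1) * character a t with hG
  have hGap : IsNormalAP G := isNormalAP_tsum_character hsum
  have hneg : ∀ {g : ℝ → ℂ}, IsNormalAP g → IsNormalAP fun t => -g t := fun hg => by
    simpa using (IsNormalAP.const (-1)).mul hg
  have hu : IsNormalAP fun t => f (t + s) + -f t + -G t :=
    ((hf.comp_add s).add (hneg hf)).add (hneg hGap)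
  have hzero := hu.eq_zero_of_hasCoeff_zero fun a => by
    have hch := continuous_character (-a)
    have hfc := hf.continuous
    have hGc : Continuous G := hGap.continuous
    have h1 := HasUniformMean.sub (by fun_prop) (hGc.mul hch)
      (HasUniformMean.sub (by fun_prop) (by fun_prop) ((hcoeff a).comp_add s) (hcoeff a))
      (hasCoeff_tsum_character hsum a)
    have e1 : character a s * c a - c a - c a * (character a s - 1) = 0 := by ring
    rw [e1] at h1
    refine Eq.mp ?_ h1
    congr 1
    ext t
    simp only [Pi.mul_apply, hG]
    ring
  have := congrFun hzero t
  simp only [Pi.zero_apply] at this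
  linear_combination this

end CharacterSeries

/-! ### Lacunary sums -/

/-- For `n ≥ 0` the bound `2` leaves the ratio `lam`; for `n ≤ 0` the bound `β^n y` leaves the ratio
`(lam β)⁻¹`. -/
theorem summable_zpow_mul_min {lam β : ℝ} (h0 : 0 < lam) (h1 : lam < 1) (hβ : 1 < β)
    (hlb : 1 < lam * β) {y : ℝ} (hy : 0 ≤ y) :
    Summable fun n : ℤ => lam ^ n * min 2 (β ^ n * y) := by
  have hβ0 : 0 < β := by linarith
  refine Summable.of_nat_of_neg ?_ ?_
  · refine Summable.of_nonneg_of_le (fun n => by positivity) (fun n => ?_)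
      ((summable_geometric_of_lt_one h0.le h1).mul_right 2)
    rw [zpow_natCast]
    have := min_le_left 2 (β ^ (n : ℤ) * y)
    gcongr
  · refine Summable.of_nonneg_of_le (fun n => by positivity) (fun n => ?_)
      ((summable_geometric_of_lt_one (inv_nonneg.2 (by positivity))
        (inv_lt_one_of_one_lt₀ hlb)).mul_right y)
    rw [zpow_neg, zpow_neg, zpow_natCast, zpow_natCast, inv_pow, mul_pow, mul_inv, mul_assoc]
    gcongr
    exact min_le_right _ _

/-- Shifting the index shows that the sum at `β^m` is `lam^(-m) = (β^m)^α` times the sum at `1`.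
Monotonicity in `y` fills the gaps between powers of `β`, at the cost of a factor `β^α`. -/
theorem exists_tsum_zpow_mul_min_le {lam β α : ℝ} (h0 : 0 < lam) (h1 : lam < 1) (hβ : 1 < β)
    (hα : 0 < α) (hlam : lam * β ^ α = 1) (hlb : 1 < lam * β) :
    ∃ C > 0, ∀ y, 0 ≤ y → ∑' n : ℤ, lam ^ n * min 2 (β ^ n * y) ≤ C * y ^ α := by
  have hβ0 : 0 < β := by linarith
  set w : ℝ → ℝ := fun y => ∑' n : ℤ, lam ^ n * min 2 (β ^ n * y) with hw
  have hs := fun {y : ℝ} (hy : 0 ≤ y) => summable_zpow_mul_min h0 h1 hβ hlb hy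
  have hw1 : 0 ≤ w 1 := tsum_nonneg fun n => by positivity
  refine ⟨β ^ α * w 1 + 1, by positivity, fun y hy => ?_⟩
  rcases hy.eq_or_lt with rfl | hy0
  · simp [Real.zero_rpow hα.ne']
  obtain ⟨N, hN1, hN2⟩ := exists_mem_Ico_zpow hy0 hβ
  have hscale : ∀ m : ℤ, w (β ^ m) = (β ^ m) ^ α * w 1 := by
    intro m
    have h2 : (β ^ m) ^ α = (lam ^ m)⁻¹ := by
      have : β ^ α = lam⁻¹ := eq_inv_of_mul_eq_one_right hlam
      rw [← Real.rpow_intCast, ← Real.rpow_mul hβ0.le, mul_comm, Real.rpow_mul hβ0.le, this,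
        Real.rpow_intCast, inv_zpow]
    have h3 : lam ^ m * w (β ^ m) = w 1 := by
      simp only [hw]
      rw [← tsum_mul_left, ← (Equiv.addRight m).tsum_eq fun n : ℤ => lam ^ n * min 2 (β ^ n * 1)]
      refine tsum_congr fun n => ?_
      simp only [Equiv.coe_addRight]
      rw [zpow_add₀ h0.ne', zpow_add₀ hβ0.ne', mul_one]
      ring
    rw [h2, ← h3, inv_mul_cancel_left₀ (by positivity)]
  have hmono : w y ≤ w (β ^ (N + 1)) := by
    refine Summable.tsum_le_tsum (fun n => ?_) (hs hy) (hs (by positivity))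
    gcongr
  have h4 : (β ^ (N + 1)) ^ α ≤ β ^ α * y ^ α := by
    rw [zpow_add_one₀ hβ0.ne', Real.mul_rpow (by positivity) hβ0.le, mul_comm]
    gcongr
  calc w y ≤ (β ^ (N + 1)) ^ α * w 1 := hmono.trans (hscale _).le
    _ ≤ β ^ α * y ^ α * w 1 := by gcongr
    _ ≤ (β ^ α * w 1 + 1) * y ^ α := by
      have := Real.rpow_nonneg hy α
      linarith

/-- An almost periodic function `q` with Fourier coefficients `c` satisfying `∑ |c_a| |a|^α < ∞`,
together with `lam` and `b` such that `lam = |b|^(-α)`. -/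
structure LacunaryData (lam b α : ℝ) (q : ℝ → ℝ) (c : ℝ → ℂ) : Prop where
  lam_pos : 0 < lam
  lam_lt_one : lam < 1
  one_lt_abs : 1 < |b|
  exponent_pos : 0 < α
  exponent_lt_one : α < 1
  lam_mul : lam * |b| ^ α = 1
  isNormalAP : IsNormalAP fun t => (q t : ℂ)
  hasCoeff : ∀ a, HasCoeff (fun t => (q t : ℂ)) a (c a)
  summable : Summable fun a => ‖c a‖ * |a| ^ α

namespace LacunaryData

variable {lam b α : ℝ} {q : ℝ → ℝ} {c : ℝ → ℂ} (h : LacunaryData lam b α q c)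
include h

theorem base_ne_zero : b ≠ 0 := abs_pos.1 (one_pos.trans h.one_lt_abs)

theorem one_lt_lam_mul : 1 < lam * |b| := by
  have h1 : |b| ^ α < |b| ^ (1 : ℝ) := Real.rpow_lt_rpow_of_exponent_lt h.one_lt_abs
    h.exponent_lt_one
  rw [Real.rpow_one] at h1
  rw [← h.lam_mul]
  have := h.lam_pos
  gcongr

theorem lam_zpow_eq (n : ℤ) : lam ^ n = (|b| ^ (-n)) ^ α := by
  have hb : 0 < |b| := one_pos.trans h.one_lt_abs
  have h1 : lam = (|b| ^ α)⁻¹ := eq_inv_of_mul_eq_one_left h.lam_mul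
  rw [← Real.rpow_intCast |b|, ← Real.rpow_mul hb.le, mul_comm, Real.rpow_mul hb.le,
    Real.rpow_intCast, zpow_neg, ← inv_zpow, ← h1]

/-- The terms of the Fourier series of the increments of `∑ lam^n q(b^n t)`. -/
theorem summable_prod (s : ℝ) :
    Summable (fun z : ℝ × ℤ => ‖(lam : ℂ) ^ z.2 * (c z.1 * (character z.1 (b ^ z.2 * s) - 1))‖) ∧
    ∀ C, (∀ y, 0 ≤ y → ∑' n : ℤ, lam ^ n * min 2 (|b| ^ n * y) ≤ C * y ^ α) →
      ∑' z : ℝ × ℤ, ‖(lam : ℂ) ^ z.2 * (c z.1 * (character z.1 (b ^ z.2 * s) - 1))‖ ≤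
        C * (∑' a, ‖c a‖ * |a| ^ α) * |s| ^ α := by
  have hlam := h.lam_pos
  have hle : ∀ z : ℝ × ℤ, ‖(lam : ℂ) ^ z.2 * (c z.1 * (character z.1 (b ^ z.2 * s) - 1))‖ ≤
      ‖c z.1‖ * (lam ^ z.2 * min 2 (|b| ^ z.2 * |z.1 * s|)) := by
    intro z
    rw [norm_mul, norm_mul, norm_zpow, Complex.norm_real, Real.norm_eq_abs, abs_of_pos hlam]
    have h1 := norm_character_sub_one_le_min z.1 (b ^ z.2 * s)
    have e : |z.1 * (b ^ z.2 * s)| = |b| ^ z.2 * |z.1 * s| := by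
      rw [abs_mul, abs_mul, abs_mul, abs_zpow]
      ring
    rw [e] at h1
    calc _ ≤ lam ^ z.2 * (‖c z.1‖ * min 2 (|b| ^ z.2 * |z.1 * s|)) := by gcongr
      _ = _ := by ring
  have hfib := fun y : ℝ => summable_zpow_mul_min h.lam_pos h.lam_lt_one h.one_lt_abs
    h.one_lt_lam_mul (abs_nonneg y)
  -- Summing over `n` first produces the weight `|a|^α`, after which (H1) sums over `a`.
  have hbound : ∀ C, (∀ y, 0 ≤ y → ∑' n : ℤ, lam ^ n * min 2 (|b| ^ n * y) ≤ C * y ^ α) →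
      ∀ a, ∑' n : ℤ, ‖c a‖ * (lam ^ n * min 2 (|b| ^ n * |a * s|)) ≤
        ‖c a‖ * |a| ^ α * (C * |s| ^ α) := by
    intro C hC a
    rw [tsum_mul_left]
    have := hC _ (abs_nonneg (a * s))
    rw [abs_mul, Real.mul_rpow (abs_nonneg _) (abs_nonneg _)] at this
    rw [abs_mul]
    calc _ ≤ ‖c a‖ * (C * (|a| ^ α * |s| ^ α)) := by gcongr
      _ = _ := by ring
  have hnn : 0 ≤ fun z : ℝ × ℤ => ‖c z.1‖ * (lam ^ z.2 * min 2 (|b| ^ z.2 * |z.1 * s|)) :=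
    fun z => by positivity
  have hsum : Summable fun z : ℝ × ℤ =>
      ‖c z.1‖ * (lam ^ z.2 * min 2 (|b| ^ z.2 * |z.1 * s|)) := by
    obtain ⟨C, -, hC⟩ := exists_tsum_zpow_mul_min_le h.lam_pos h.lam_lt_one h.one_lt_abs
      h.exponent_pos h.lam_mul h.one_lt_lam_mul
    refine (summable_prod_of_nonneg hnn).2 ⟨fun a => (hfib (a * s)).mul_left ‖c a‖, ?_⟩
    exact Summable.of_nonneg_of_le (fun a => tsum_nonneg fun n => hnn (a, n)) (hbound C hC)
      (h.summable.mul_right (C * |s| ^ α))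
  refine ⟨Summable.of_nonneg_of_le (fun _ => norm_nonneg _) hle hsum, fun C hC => ?_⟩
  calc _ ≤ ∑' z : ℝ × ℤ, ‖c z.1‖ * (lam ^ z.2 * min 2 (|b| ^ z.2 * |z.1 * s|)) :=
        Summable.tsum_le_tsum hle (Summable.of_nonneg_of_le (fun _ => norm_nonneg _) hle hsum) hsum
    _ = ∑' a, ∑' n : ℤ, ‖c a‖ * (lam ^ n * min 2 (|b| ^ n * |a * s|)) := hsum.tsum_prod
    _ ≤ ∑' a, ‖c a‖ * |a| ^ α * (C * |s| ^ α) :=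
        Summable.tsum_le_tsum (hbound C hC) hsum.prod (h.summable.mul_right (C * |s| ^ α))
    _ = _ := by
        rw [tsum_mul_right]
        ring

theorem translate_sub_eq_tsum (s t : ℝ) :
    ((q (t + s) : ℂ) - q t) = ∑' a, c a * (character a s - 1) * character a t :=
  h.isNormalAP.translate_sub_eq_tsum h.hasCoeff h.exponent_pos h.exponent_lt_one.le h.summable s t

/-- The increments of the two-sided sum `∑_{n ∈ ℤ} lam^n q(b^n t)` converge absolutely, and are
Hölder of exponent `α`. -/
theorem exists_tsum_abs_increment_le : ∃ C > 0, ∀ s t : ℝ,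
    Summable (fun n : ℤ => |lam ^ n * (q (b ^ n * (t + s)) - q (b ^ n * t))|) ∧
    ∑' n : ℤ, |lam ^ n * (q (b ^ n * (t + s)) - q (b ^ n * t))| ≤ C * |s| ^ α := by
  obtain ⟨C, hC0, hC⟩ := exists_tsum_zpow_mul_min_le h.lam_pos h.lam_lt_one h.one_lt_abs
    h.exponent_pos h.lam_mul h.one_lt_lam_mul
  refine ⟨C * (∑' a, ‖c a‖ * |a| ^ α) + 1, ?_, fun s t => ?_⟩
  · have : 0 ≤ ∑' a, ‖c a‖ * |a| ^ α := tsum_nonneg fun a => by positivity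
    positivity
  obtain ⟨hsum, hle⟩ := h.summable_prod s
  have hsw : Summable fun z : ℤ × ℝ =>
      ‖(lam : ℂ) ^ z.1 * (c z.2 * (character z.2 (b ^ z.1 * s) - 1))‖ := hsum.prod_symm
  have hterm : ∀ n : ℤ, |lam ^ n * (q (b ^ n * (t + s)) - q (b ^ n * t))| ≤
      ∑' a, ‖(lam : ℂ) ^ n * (c a * (character a (b ^ n * s) - 1))‖ := by
    intro n
    have h1 := h.translate_sub_eq_tsum (b ^ n * s) (b ^ n * t)
    rw [← mul_add] at h1
    have h2 : |lam ^ n * (q (b ^ n * (t + s)) - q (b ^ n * t))| =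
        ‖(lam : ℂ) ^ n * ((q (b ^ n * (t + s)) : ℂ) - q (b ^ n * t))‖ := by
      rw [← Real.norm_eq_abs, ← Complex.norm_real]
      push_cast
      rfl
    have h3 : Summable fun a => ‖(lam : ℂ) ^ n * (c a * (character a (b ^ n * s) - 1))‖ :=
      hsw.prod_factor n
    rw [h2, h1, ← tsum_mul_left]
    have e : ∀ a, ‖(lam : ℂ) ^ n * (c a * (character a (b ^ n * s) - 1))‖ =
        ‖(lam : ℂ) ^ n * (c a * (character a (b ^ n * s) - 1) * character a (b ^ n * t))‖ := by
      intro a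
      simp only [norm_mul, norm_character, mul_one]
    simp only [e] at h3 ⊢
    exact norm_tsum_le_tsum_norm h3
  have hs1 := Summable.of_nonneg_of_le (fun _ => abs_nonneg _) hterm hsw.prod
  refine ⟨hs1, ?_⟩
  calc _ ≤ ∑' (n : ℤ) (a : ℝ), ‖(lam : ℂ) ^ n * (c a * (character a (b ^ n * s) - 1))‖ :=
        Summable.tsum_le_tsum hterm hs1 hsw.prod
    _ = ∑' z : ℝ × ℤ, ‖(lam : ℂ) ^ z.2 * (c z.1 * (character z.1 (b ^ z.2 * s) - 1))‖ := by
        rw [← hsw.tsum_prod, ← (Equiv.prodComm ℤ ℝ).tsum_eq]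
        rfl
    _ ≤ C * (∑' a, ‖c a‖ * |a| ^ α) * |s| ^ α := hle C hC
    _ ≤ _ := by
        have := Real.rpow_nonneg (abs_nonneg s) α
        linarith

end LacunaryData

/-- The increment over `[t, t + s]` of the two-sided sum `∑_{n ∈ ℤ} lam^n q(b^n t)`. -/
noncomputable def increment (lam b : ℝ) (q : ℝ → ℝ) (s t : ℝ) : ℝ :=
  ∑' n : ℤ, lam ^ n * (q (b ^ n * (t + s)) - q (b ^ n * t))

/-- The part of the two-sided sum with negative indices, normalised to vanish at `0`. -/
noncomputable def smoothPart (lam b : ℝ) (q : ℝ → ℝ) (t : ℝ) : ℝ :=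
  ∑' n : ℕ, lam⁻¹ ^ (n + 1) * (q (b⁻¹ ^ (n + 1) * t) - q 0)

/-- Self-similarity of the two-sided sum, by shifting the index by `N`. It transfers information
about one fixed step `s` to arbitrarily small steps. -/
theorem increment_scale {lam b : ℝ} (hlam : lam ≠ 0) (hb : b ≠ 0) (q : ℝ → ℝ) (s t : ℝ) (N : ℤ) :
    increment lam b q (b ^ (-N) * s) t = lam ^ N * increment lam b q s (b ^ N * t) := by
  rw [increment, increment, ← tsum_mul_left, ← (Equiv.addRight N).tsum_eq]
  refine tsum_congr fun n => ?_
  have e1 : b ^ (n + N) * (t + b ^ (-N) * s) = b ^ n * (b ^ N * t + s) := by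
    have : b ^ N * b ^ (-N) = 1 := by rw [← zpow_add₀ hb, add_neg_cancel, zpow_zero]
    rw [zpow_add₀ hb]
    linear_combination b ^ n * s * this
  have e2 : b ^ (n + N) * t = b ^ n * (b ^ N * t) := by
    rw [zpow_add₀ hb, mul_assoc]
  simp only [Equiv.coe_addRight]
  rw [e1, e2, zpow_add₀ hlam]
  ring

/-! ### Differentiability of the negative-index half. -/

section SmoothPart

variable {lam b : ℝ} {q : ℝ → ℝ}

/-- `smoothPart` may be differentiated term by term on every ball. -/
theorem hasDerivAt_smoothPart (hlam : 0 < lam) (hb : 1 < |b|) (hlb : 1 < lam * |b|)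
    (hq : ContDiff ℝ 1 q) {R : ℝ} (hR : 0 < R) :
    (∀ t ∈ Metric.ball (0 : ℝ) R, Summable (fun n : ℕ =>
      lam⁻¹ ^ (n + 1) * (q (b⁻¹ ^ (n + 1) * t) - q 0))) ∧
    (∀ t ∈ Metric.ball (0 : ℝ) R, HasDerivAt (smoothPart lam b q)
      (∑' n : ℕ, (lam * b)⁻¹ ^ (n + 1) * deriv q (b⁻¹ ^ (n + 1) * t)) t) ∧
    ContinuousOn (fun t =>
      ∑' n : ℕ, (lam * b)⁻¹ ^ (n + 1) * deriv q (b⁻¹ ^ (n + 1) * t))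
      (Metric.ball (0 : ℝ) R) := by
  obtain ⟨hd, hc⟩ := contDiff_one_iff_deriv.1 hq
  -- A local bound on `q'` is enough: multiplication by powers of `b⁻¹` keeps the arguments in the
  -- ball.
  obtain ⟨M, hM⟩ := (isCompact_closedBall (0 : ℝ) R).exists_bound_of_continuousOn hc.continuousOn
  have hr0 : 0 ≤ (lam * |b|)⁻¹ := by positivity
  have hu : Summable fun n : ℕ => (lam * |b|)⁻¹ * (lam * |b|)⁻¹ ^ n * M :=
    ((summable_geometric_of_lt_one hr0 (inv_lt_one_of_one_lt₀ hlb)).mul_left _).mul_right _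
  have hder : ∀ (n : ℕ) (t : ℝ), t ∈ Metric.ball (0 : ℝ) R → HasDerivAt
      (fun t => lam⁻¹ ^ (n + 1) * (q (b⁻¹ ^ (n + 1) * t) - q 0))
      ((lam * b)⁻¹ ^ (n + 1) * deriv q (b⁻¹ ^ (n + 1) * t)) t := by
    intro n t _
    have h1 : HasDerivAt (fun t : ℝ => b⁻¹ ^ (n + 1) * t) (b⁻¹ ^ (n + 1)) t := by
      simpa using (hasDerivAt_id t).const_mul (b⁻¹ ^ (n + 1))
    have h2 := (((hd (b⁻¹ ^ (n + 1) * t)).hasDerivAt.comp t h1).sub_const (q 0)).const_mul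
      (lam⁻¹ ^ (n + 1))
    convert! h2 using 1
    rw [mul_inv, mul_pow]
    ring
  have hbd : ∀ (n : ℕ) (t : ℝ), t ∈ Metric.ball (0 : ℝ) R →
      ‖(lam * b)⁻¹ ^ (n + 1) * deriv q (b⁻¹ ^ (n + 1) * t)‖ ≤
        (lam * |b|)⁻¹ * (lam * |b|)⁻¹ ^ n * M := by
    intro n t ht
    have h1 : ‖(lam * b)⁻¹ ^ (n + 1)‖ = (lam * |b|)⁻¹ * (lam * |b|)⁻¹ ^ n := by
      rw [norm_pow, norm_inv, Real.norm_eq_abs, abs_mul, abs_of_pos hlam, pow_succ']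
    have h2 : |b⁻¹ ^ (n + 1) * t| ≤ R := by
      rw [abs_mul, abs_pow, abs_inv]
      have h3 : |b|⁻¹ ^ (n + 1) ≤ 1 := pow_le_one₀ (by positivity) (inv_le_one_of_one_le₀ hb.le)
      have h4 : |t| < R := by simpa using ht
      calc _ ≤ 1 * |t| := by gcongr
        _ ≤ R := by linarith
    rw [norm_mul, h1]
    gcongr
    exact hM _ (by simpa using h2)
  have h0 : Summable fun n : ℕ =>
      lam⁻¹ ^ (n + 1) * (q (b⁻¹ ^ (n + 1) * 0) - q 0) := by
    simp
  have hmem : (0 : ℝ) ∈ Metric.ball (0 : ℝ) R := Metric.mem_ball_self hR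
  have hconn := (convex_ball (0 : ℝ) R).isPreconnected
  refine ⟨fun t ht => ?_, fun t ht => ?_, ?_⟩
  · have h1 := summable_of_summable_hasDerivAt_of_isPreconnected (y₀ := 0) (y := t) hu
      Metric.isOpen_ball hconn hder hbd hmem
    exact h1 h0 ht
  · have h1 := hasDerivAt_tsum_of_isPreconnected (y₀ := 0) (y := t) hu
      Metric.isOpen_ball hconn hder hbd hmem
    exact h1 h0 ht
  · exact continuousOn_tsum (fun n => Continuous.continuousOn (by fun_prop)) hu hbd

theorem contDiff_smoothPart (hlam : 0 < lam) (hb : 1 < |b|) (hlb : 1 < lam * |b|)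
    (hq : ContDiff ℝ 1 q) : ContDiff ℝ 1 (smoothPart lam b q) := by
  have key := fun {R : ℝ} (hR : 0 < R) => hasDerivAt_smoothPart hlam hb hlb hq hR
  have hmem : ∀ t : ℝ, t ∈ Metric.ball (0 : ℝ) (|t| + 1) := fun t => by simp
  have hderiv := fun t : ℝ => (key (R := |t| + 1) (by positivity)).2.1 t (hmem t)
  refine contDiff_one_iff_deriv.2 ⟨fun t => (hderiv t).differentiableAt, ?_⟩
  have e := funext fun t => (hderiv t).deriv
  rw [e, continuous_iff_continuousAt]
  exact fun t => (key (R := |t| + 1) (by positivity)).2.2.continuousAt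
    (Metric.isOpen_ball.mem_nhds (hmem t))

theorem summable_lacunary (hlam : 0 < lam) (hlam1 : lam < 1) {C : ℝ} (hq : ∀ t, |q t| ≤ C)
    (t : ℝ) : Summable fun n : ℕ => lam ^ n * q (b ^ n * t) := by
  refine Summable.of_norm_bounded ((summable_geometric_of_lt_one hlam.le hlam1).mul_right C)
    fun n => ?_
  rw [norm_mul, Real.norm_eq_abs, Real.norm_eq_abs, abs_of_pos (pow_pos hlam n)]
  have := hq (b ^ n * t)
  gcongr

end SmoothPart

namespace LacunaryData

variable {lam b α : ℝ} {q : ℝ → ℝ}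

section

variable {c : ℝ → ℂ} (h : LacunaryData lam b α q c)
include h

theorem exists_bound : ∃ C, ∀ t, |q t| ≤ C := by
  obtain ⟨C, -, hC⟩ := h.isNormalAP.exists_bound
  exact ⟨C, fun t => by simpa using hC t⟩

theorem lacunarySum_sub (s t : ℝ) :
    SkewGraph.lacunarySum lam b q (t + s) - SkewGraph.lacunarySum lam b q t =
      ∑' n : ℕ, lam ^ n * (q (b ^ n * (t + s)) - q (b ^ n * t)) := by
  obtain ⟨C, hC⟩ := h.exists_bound
  have hs := fun t => summable_lacunary (b := b) h.lam_pos h.lam_lt_one hC t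
  simp only [SkewGraph.lacunarySum]
  rw [← (hs _).tsum_sub (hs _)]
  exact tsum_congr fun n => by ring

/-- The lacunary sum is Hölder continuous of exponent `α`. -/
theorem exists_lacunarySum_holder : ∃ C > 0, ∀ s t : ℝ,
    |SkewGraph.lacunarySum lam b q (t + s) - SkewGraph.lacunarySum lam b q t| ≤ C * |s| ^ α := by
  obtain ⟨C, hC0, hC⟩ := h.exists_tsum_abs_increment_le
  refine ⟨C, hC0, fun s t => ?_⟩
  obtain ⟨hs, hle⟩ := hC s t
  have hinj : Function.Injective ((↑) : ℕ → ℤ) := Nat.cast_injective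
  have hcomp : ∀ F : ℤ → ℝ, Summable F → (∀ n, 0 ≤ F n) →
      (Summable fun n : ℕ => F n) ∧ ∑' n : ℕ, F n ≤ ∑' n, F n := fun F hF hF0 =>
    ⟨hF.comp_injective hinj, (hF.comp_injective hinj).tsum_le_tsum_of_inj _ hinj
      (fun _ _ => hF0 _) (fun _ => le_rfl) hF⟩
  obtain ⟨hs', hle'⟩ := hcomp _ hs fun _ => abs_nonneg _
  rw [h.lacunarySum_sub]
  simp only [zpow_natCast] at hs' hle'
  calc _ ≤ ∑' n : ℕ, |lam ^ n * (q (b ^ n * (t + s)) - q (b ^ n * t))| := by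
        simpa only [Real.norm_eq_abs] using norm_tsum_le_tsum_norm (f := fun n : ℕ =>
          lam ^ n * (q (b ^ n * (t + s)) - q (b ^ n * t))) hs'
    _ ≤ _ := hle'.trans hle

theorem continuous_lacunarySum : Continuous (SkewGraph.lacunarySum lam b q) := by
  obtain ⟨C, hC0, hC⟩ := h.exists_lacunarySum_holder
  rw [continuous_iff_continuousAt]
  intro t
  rw [ContinuousAt, tendsto_iff_norm_sub_tendsto_zero]
  refine squeeze_zero (fun _ => norm_nonneg _) (fun x => ?_)
    (g := fun x => C * |x - t| ^ α) ?_
  · simpa using hC (x - t) t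
  · have hα := h.exponent_pos
    have : Continuous fun x : ℝ => C * |x - t| ^ α :=
      continuous_const.mul ((by fun_prop : Continuous fun x : ℝ => |x - t|).rpow_const
        fun _ => Or.inr hα.le)
    simpa [Real.zero_rpow hα.ne'] using this.tendsto t

/-- The sum over `ℤ` is split into `n ≥ 0` and `n ≤ -1`. The normalising constants `q 0` cancel in
the difference. -/
theorem increment_eq (hq : ContDiff ℝ 1 q) (s t : ℝ) : increment lam b q s t =
    (SkewGraph.lacunarySum lam b q (t + s) - SkewGraph.lacunarySum lam b q t) +
      (smoothPart lam b q (t + s) - smoothPart lam b q t) := by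
  obtain ⟨C, hC0, hC⟩ := h.exists_tsum_abs_increment_le
  have hs : Summable fun n : ℤ => lam ^ n * (q (b ^ n * (t + s)) - q (b ^ n * t)) :=
    Summable.of_norm (hC s t).1
  have hsm : ∀ t, Summable fun n : ℕ => lam⁻¹ ^ (n + 1) * (q (b⁻¹ ^ (n + 1) * t) - q 0) :=
    fun t => (hasDerivAt_smoothPart h.lam_pos h.one_lt_abs h.one_lt_lam_mul hq (R := |t| + 1)
      (by positivity)).1 t (by simp)
  have hneg : ∀ (r : ℝ) (n : ℕ), r ^ (-((n : ℤ) + 1)) = r⁻¹ ^ (n + 1) := fun r n => by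
    rw [zpow_neg, ← Nat.cast_succ, zpow_natCast, inv_pow]
  have hinj : Function.Injective fun n : ℕ => -((n : ℤ) + 1) := fun m n hmn => by
    simp only at hmn
    omega
  have e1 : ∀ F : ℤ → ℝ, Summable F → ∑' n, F n = ∑' n : ℕ, F n + ∑' n : ℕ, F (-((n : ℤ) + 1)) :=
    fun F hF => tsum_of_nat_of_neg_add_one (hF.comp_injective (Nat.cast_injective (R := ℤ)))
      (hF.comp_injective hinj)
  replace e1 := e1 _ hs
  simp only [zpow_natCast, hneg] at e1
  rw [increment, e1, h.lacunarySum_sub, smoothPart, smoothPart, ← (hsm _).tsum_sub (hsm _)]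
  congr 1
  exact tsum_congr fun n => by ring

end

/-! ### Fourier series of the increments and their mean size. -/

section

variable (h : LacunaryData lam b α q (SkewGraph.fourierCoeffAP q))
include h

open SkewGraph in
-- Since `lam^n = |b^(-n)|^α`, the norms of the terms are, up to the factor `|σ|^(-α)`, the terms of
-- (H1) at the distinct frequencies `σ b^(-n)`.
theorem summable_gCoeffTerm {σ : ℝ} (hσ : σ ≠ 0) : Summable (gCoeffTerm lam b q σ) := by
  have hinj : Function.Injective fun n : ℤ => σ * b ^ (-n) := by
    intro m n hmn
    have h1 := congrArg abs (mul_left_cancel₀ hσ hmn)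
    rw [abs_zpow, abs_zpow] at h1
    have := zpow_right_injective₀ (one_pos.trans h.one_lt_abs) h.one_lt_abs.ne' h1
    omega
  have hs := (h.summable.comp_injective hinj).mul_right (|σ| ^ α)⁻¹
  have hσ' : |σ| ^ α ≠ 0 := (Real.rpow_pos_of_pos (abs_pos.2 hσ) α).ne'
  have key : ∀ n, ‖gCoeffTerm lam b q σ n‖ =
      ‖fourierCoeffAP q (σ * b ^ (-n))‖ * |σ * b ^ (-n)| ^ α * (|σ| ^ α)⁻¹ := by
    intro n
    rw [gCoeffTerm, norm_mul, Complex.norm_real, Real.norm_eq_abs,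
      abs_of_pos (zpow_pos h.lam_pos n), abs_mul, abs_zpow,
      Real.mul_rpow (abs_nonneg _) (by positivity), ← h.lam_zpow_eq]
    field_simp
  refine Summable.of_norm ?_
  simp only [key]
  exact hs

open SkewGraph in
/-- The Fourier series of the increments of the two-sided sum. -/
theorem increment_eq_tsum_gCoeff (s : ℝ) :
    Summable (fun σ => ‖gCoeff lam b q σ * (character σ s - 1)‖) ∧
    ∀ t, (increment lam b q s t : ℂ) =
      ∑' σ, gCoeff lam b q σ * (character σ s - 1) * character σ t := by
  have hb := h.base_ne_zero
  set X : ℝ → ℝ × ℤ → ℂ := fun t z => (lam : ℂ) ^ z.2 *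
    (fourierCoeffAP q z.1 * (character z.1 (b ^ z.2 * s) - 1)) * character z.1 (b ^ z.2 * t) with hX
  have hXs : ∀ t, Summable fun z => ‖X t z‖ := by
    intro t
    simp only [hX, norm_mul _ (character _ _), norm_character, mul_one]
    exact (h.summable_prod s).1
  -- The frequency `a` of `q` contributes the frequency `σ = a b^n` to the `n`-th term. Reindexing
  -- by `(σ, n)` collects everything of frequency `σ`, which gives `g_σ`.
  let e : ℝ × ℤ ≃ ℝ × ℤ :=
    { toFun := fun z => (z.1 * b ^ (-z.2), z.2)
      invFun := fun z => (z.1 * b ^ z.2, z.2)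
      left_inv := fun z => by
        simp only [mul_assoc, ← zpow_add₀ hb, neg_add_cancel, zpow_zero, mul_one]
      right_inv := fun z => by
        simp only [mul_assoc, ← zpow_add₀ hb, add_neg_cancel, zpow_zero, mul_one] }
  have hXe : ∀ t σ n, X t (e (σ, n)) =
      gCoeffTerm lam b q σ n * ((character σ s - 1) * character σ t) := by
    intro t σ n
    have hch : ∀ u, character (σ * b ^ (-n)) (b ^ n * u) = character σ u := by
      intro u
      rw [character_mul_freq, ← mul_assoc, ← zpow_add₀ hb, neg_add_cancel, zpow_zero, one_mul]
    simp only [hX, e, Equiv.coe_fn_mk, hch, gCoeffTerm]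
    push_cast
    ring
  clear_value e X
  have hXes : ∀ t, Summable fun z => ‖X t (e z)‖ := fun t => e.summable_iff.2 (hXs t)
  constructor
  · have hp := (hXes 0).prod
    refine Summable.of_nonneg_of_le (fun _ => norm_nonneg _) (fun σ => ?_) hp
    have h1 := norm_tsum_le_tsum_norm ((hXes 0).prod_factor σ)
    simp only [hXe, tsum_mul_right, character_zero, mul_one] at h1 ⊢
    exact h1
  · intro t
    have hsw : Summable fun z : ℤ × ℝ => X t z.swap := (Summable.of_norm (hXs t)).prod_symm
    have h1 : (increment lam b q s t : ℂ) = ∑' (n : ℤ) (a : ℝ), X t (a, n) := by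
      rw [increment, Complex.ofReal_tsum]
      refine tsum_congr fun n => ?_
      have h2 := h.translate_sub_eq_tsum (b ^ n * s) (b ^ n * t)
      rw [← mul_add] at h2
      push_cast
      rw [h2, ← tsum_mul_left]
      exact tsum_congr fun a => by simp only [hX]; ring
    have h3 : ∑' (n : ℤ) (a : ℝ), X t (a, n) = ∑' z, X t z := by
      rw [← (Equiv.prodComm ℤ ℝ).tsum_eq]
      exact hsw.tsum_prod.symm
    rw [h1, h3, ← e.tsum_eq, (Summable.of_norm (hXes t)).tsum_prod]
    refine tsum_congr fun σ => ?_
    simp only [hXe, tsum_mul_right]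
    rw [← gCoeff, mul_assoc]

open SkewGraph in
-- The term `σ = 0` drops out of the Fourier series because `e^{iσs} - 1 = 0`. Hence all increments
-- from `0` vanish, and the lacunary sum is a constant minus `smoothPart`.
theorem contDiff_lacunarySum (hq : ContDiff ℝ 1 q)
    (hg : ∀ σ : ℝ, σ ≠ 0 → gCoeff lam b q σ = 0) : ContDiff ℝ 1 (lacunarySum lam b q) := by
  have h0 : ∀ t, increment lam b q t 0 = 0 := by
    intro t
    have h1 := (h.increment_eq_tsum_gCoeff t).2 0
    have h2 : ∀ σ, gCoeff lam b q σ * (character σ t - 1) * character σ 0 = 0 := by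
      intro σ
      rcases eq_or_ne σ 0 with rfl | hσ
      · simp
      · simp [hg σ hσ]
    simp only [h2, tsum_zero] at h1
    exact_mod_cast h1
  have e : lacunarySum lam b q = fun t =>
      lacunarySum lam b q 0 + smoothPart lam b q 0 - smoothPart lam b q t := by
    ext t
    have := h.increment_eq hq t 0
    rw [h0, zero_add] at this
    linarith
  rw [e]
  exact contDiff_const.sub (contDiff_smoothPart h.lam_pos h.one_lt_abs h.one_lt_lam_mul hq)

open SkewGraph in
/-- If some `g_σ` with `σ ≠ 0` is non-zero, then the increments of the two-sided sum over intervals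
of a suitable fixed length are non-trivial on average. -/
theorem exists_integral_abs_increment_ge {σ : ℝ} (hσ : σ ≠ 0) (hg : gCoeff lam b q σ ≠ 0) :
    ∃ s ≠ 0, Continuous (increment lam b q s) ∧ ∃ k > 0, ∃ T₀ > 0, ∀ T ≥ T₀, ∀ x,
      k * T ≤ ∫ u in x..x + T, |increment lam b q s u| := by
  have hσ' : (σ : ℂ) ≠ 0 := by exact_mod_cast hσ
  -- With the step `π / σ`, the coefficient of the increment at `σ` is `-2 g_σ ≠ 0`.
  have hch : character σ (Real.pi / σ) = -1 := by
    have : Complex.I * (σ : ℂ) * ((Real.pi / σ : ℝ) : ℂ) = Real.pi * Complex.I := by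
      push_cast
      field_simp
    rw [character, this, Complex.exp_pi_mul_I]
  obtain ⟨hsum, heq⟩ := h.increment_eq_tsum_gCoeff (Real.pi / σ)
  have e := funext heq
  have hap := isNormalAP_tsum_character hsum
  have hco := hasCoeff_tsum_character hsum σ
  rw [← e] at hap hco
  have hcont : Continuous (increment lam b q (Real.pi / σ)) :=
    Complex.continuous_re.comp hap.continuous
  obtain ⟨κ, hκ⟩ : ∃ κ, κ = gCoeff lam b q σ * (character σ (Real.pi / σ) - 1) := ⟨_, rfl⟩
  rw [← hκ] at hco
  have hκ0 : 0 < ‖κ‖ := by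
    rw [hκ, hch]
    exact norm_pos_iff.2 (mul_ne_zero hg (by norm_num))
  obtain ⟨T₀, hT₀, hT⟩ := hco (‖κ‖ / 2) (by positivity)
  refine ⟨Real.pi / σ, div_ne_zero Real.pi_ne_zero hσ, hcont, ‖κ‖ / 2, by positivity, T₀, hT₀,
    fun T hTT x => ?_⟩
  have hT0 : 0 < T := hT₀.trans_le hTT
  have h1 := hT T hTT x
  rw [norm_sub_rev] at h1
  have h2 : ‖κ‖ / 2 ≤ ‖avg (fun t => (increment lam b q (Real.pi / σ) t : ℂ) *
      character (-σ) t) x T‖ := by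
    linarith [norm_le_norm_sub_add κ (avg (fun t => (increment lam b q (Real.pi / σ) t : ℂ) *
      character (-σ) t) x T)]
  rw [avg, intervalIntegral.integral_comp_add_left
    (fun t => (increment lam b q (Real.pi / σ) t : ℂ) * character (-σ) t) x, add_zero, norm_mul,
    norm_inv, Complex.norm_real, Real.norm_eq_abs, abs_of_pos hT0, ← div_eq_inv_mul,
    le_div_iff₀ hT0] at h2
  refine h2.trans ?_
  refine (intervalIntegral.norm_integral_le_integral_norm (by linarith)).trans (le_of_eq ?_)
  simp only [norm_mul, norm_character, mul_one, Complex.norm_real, Real.norm_eq_abs]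

open SkewGraph in
/-- The mean oscillation of the lacunary sum at the scales `|b|^(-N)`. -/
theorem exists_integral_abs_lacunarySum_ge (hq : ContDiff ℝ 1 q) {σ : ℝ} (hσ : σ ≠ 0)
    (hg : gCoeff lam b q σ ≠ 0) {c d : ℝ} (hcd : c < d) :
    ∃ s ≠ 0, ∃ A > 0, ∀ᶠ N : ℕ in atTop, A * lam ^ N ≤
      ∫ t in c..d, |lacunarySum lam b q (t + b ^ (-(N : ℤ)) * s) - lacunarySum lam b q t| := by
  obtain ⟨s, hs, hcont, k, hk, T₀, hT₀, hT⟩ := h.exists_integral_abs_increment_ge hσ hg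
  have hb := h.base_ne_zero
  have hb1 := h.one_lt_abs
  have hlam := h.lam_pos
  have hdc : 0 < d - c := sub_pos.2 hcd
  -- The interval is enlarged by `1` so that it also contains `t + s'` once `|s'| < 1`.
  obtain ⟨K, hK⟩ := ((contDiff_smoothPart hlam hb1 h.one_lt_lam_mul
    hq).locallyLipschitz.locallyLipschitzOn (s := Set.Icc (c - 1) (d + 1))
    ).exists_lipschitzOnWith_of_compact isCompact_Icc
  -- The substitution `u = b^N t` stretches `[c, d]` to a length at least `T₀`. As `b` may be
  -- negative, the orientation of the image must be distinguished.
  have hscale : ∀ N : ℕ, T₀ ≤ |b| ^ N * (d - c) → k * (d - c) * lam ^ N ≤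
      ∫ t in c..d, |increment lam b q (b ^ (-(N : ℤ)) * s) t| := by
    intro N hN
    simp only [increment_scale hlam.ne' hb, abs_mul, intervalIntegral.integral_const_mul,
      zpow_natCast, abs_of_pos (pow_pos hlam N)]
    rw [intervalIntegral.integral_comp_mul_left (fun t => |increment lam b q s t|)
      (pow_ne_zero N hb), smul_eq_mul]
    have h1 : k * (d - c) ≤
        (b ^ N)⁻¹ * ∫ t in b ^ N * c..b ^ N * d, |increment lam b q s t| := by
      rw [← abs_pow] at hN
      rcases lt_or_gt_of_ne (pow_ne_zero N hb) with hneg | hpos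
      · rw [abs_of_neg hneg] at hN
        have h2 := hT _ hN (b ^ N * d)
        have e2 : b ^ N * d + -b ^ N * (d - c) = b ^ N * c := by ring
        rw [e2] at h2
        rw [intervalIntegral.integral_symm, mul_neg, ← neg_mul, ← inv_neg, ← div_eq_inv_mul,
          le_div_iff₀ (by linarith)]
        linarith
      · rw [abs_of_pos hpos] at hN
        have h2 := hT _ hN (b ^ N * c)
        have e2 : b ^ N * c + b ^ N * (d - c) = b ^ N * d := by ring
        rw [e2] at h2
        rw [← div_eq_inv_mul, le_div_iff₀ hpos]
        linarith
    calc _ = lam ^ N * (k * (d - c)) := by ring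
      _ ≤ _ := by gcongr
  -- The Lipschitz error `K |s| |b|^(-N)` of the smooth half is `o(lam^N)`, so it eventually costs
  -- at most half of `k`.
  have hlim : Tendsto (fun N : ℕ => (lam * |b|)⁻¹ ^ N * (K * |s|)) atTop (𝓝 0) := by
    simpa using (tendsto_pow_atTop_nhds_zero_of_lt_one (r := (lam * |b|)⁻¹) (by positivity)
      (inv_lt_one_of_one_lt₀ h.one_lt_lam_mul)).mul_const (K * |s|)
  have hlim2 : Tendsto (fun N : ℕ => |b|⁻¹ ^ N * |s|) atTop (𝓝 0) := by
    simpa using (tendsto_pow_atTop_nhds_zero_of_lt_one (r := |b|⁻¹) (by positivity)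
      (inv_lt_one_of_one_lt₀ hb1)).mul_const |s|
  have hlim3 : Tendsto (fun N : ℕ => |b| ^ N * (d - c)) atTop atTop :=
    (tendsto_pow_atTop_atTop_of_one_lt hb1).atTop_mul_const hdc
  refine ⟨s, hs, k / 2 * (d - c), by positivity, ?_⟩
  filter_upwards [hlim.eventually (gt_mem_nhds (show 0 < k / 2 by positivity)),
    hlim2.eventually (gt_mem_nhds one_pos), hlim3.eventually_ge_atTop T₀] with N h1 h2 h3
  have hs' : |b ^ (-(N : ℤ)) * s| = |b|⁻¹ ^ N * |s| := by
    rw [abs_mul, abs_zpow, zpow_neg, zpow_natCast, inv_pow]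
  rw [← hs'] at h2
  set s' := b ^ (-(N : ℤ)) * s with hs'def
  have hφ := h.continuous_lacunarySum
  have hinc : Continuous (increment lam b q s') := by
    have : increment lam b q s' = fun t => lam ^ (N : ℤ) * increment lam b q s (b ^ (N : ℤ) * t) :=
      funext fun t => increment_scale hlam.ne' hb q s t N
    rw [this]
    fun_prop
  have hpt : ∀ t ∈ Set.Icc c d, |increment lam b q s' t| - K * |s'| ≤
      |lacunarySum lam b q (t + s') - lacunarySum lam b q t| := by
    intro t ht
    have h4 := abs_lt.1 h2
    have h5 := hK.dist_le_mul (t + s') ⟨by linarith [ht.1], by linarith [ht.2]⟩ t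
      ⟨by linarith [ht.1], by linarith [ht.2]⟩
    rw [Real.dist_eq, Real.dist_eq, add_sub_cancel_left] at h5
    rw [h.increment_eq hq]
    linarith [abs_add_le (lacunarySum lam b q (t + s') - lacunarySum lam b q t)
      (smoothPart lam b q (t + s') - smoothPart lam b q t)]
  have h6 := intervalIntegral.integral_mono_on (μ := MeasureTheory.volume) hcd.le
    (Continuous.intervalIntegrable (by fun_prop) _ _)
    (Continuous.intervalIntegrable (by fun_prop) _ _) hpt
  rw [intervalIntegral.integral_sub (Continuous.intervalIntegrable (by fun_prop) _ _)
    (Continuous.intervalIntegrable (by fun_prop) _ _), intervalIntegral.integral_const,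
    smul_eq_mul] at h6
  have h7 := hscale N h3
  have h8 : K * |s'| ≤ k / 2 * lam ^ N := by
    have hp := pow_pos hlam N
    have : K * |s'| = lam ^ N * ((lam * |b|)⁻¹ ^ N * (K * |s|)) := by
      rw [hs', mul_inv, mul_pow, inv_pow lam]
      field_simp
    rw [this, mul_comm]
    gcongr
  have h9 := mul_le_mul_of_nonneg_left h8 hdc.le
  linarith

end

end LacunaryData

/-! ### Covering numbers -/

namespace SkewGraph

section Cover

variable {M : Type*} [PseudoMetricSpace M]

theorem coverNumber_le_card {ι : Type*} [Fintype ι] {δ : ℝ} {X : Set M} (U : ι → Set M)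
    (hU : ∀ j, Bornology.IsBounded (U j) ∧ Metric.diam (U j) ≤ δ) (hX : X ⊆ ⋃ j, U j) :
    coverNumber δ X ≤ Fintype.card ι := by
  refine Nat.sInf_le ⟨fun j => U ((Fintype.equivFin ι).symm j), fun j => hU _, fun x hx => ?_⟩
  obtain ⟨j, hj⟩ := Set.mem_iUnion.1 (hX hx)
  exact Set.mem_iUnion.2 ⟨Fintype.equivFin ι j, by simpa using hj⟩

/-- Total boundedness makes the set of admissible cardinalities nonempty, so that its infimum is
attained rather than being the default `0`. -/
theorem exists_cover {δ : ℝ} (hδ : 0 < δ) {X : Set M} (hX : TotallyBounded X) :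
    ∃ U : Fin (coverNumber δ X) → Set M,
      (∀ j, Bornology.IsBounded (U j) ∧ Metric.diam (U j) ≤ δ) ∧ X ⊆ ⋃ j, U j := by
  refine Nat.sInf_mem (s := {n : ℕ | ∃ U : Fin n → Set M,
    (∀ j, Bornology.IsBounded (U j) ∧ Metric.diam (U j) ≤ δ) ∧ X ⊆ ⋃ j, U j}) ?_
  obtain ⟨t, ht, hcov⟩ := Metric.totallyBounded_iff.1 hX (δ / 2) (half_pos hδ)
  have := ht.fintype
  refine ⟨Fintype.card t, fun j => Metric.ball ((Fintype.equivFin t).symm j : M) (δ / 2),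
    fun j => ⟨Metric.isBounded_ball, ?_⟩, fun x hx => ?_⟩
  · exact (Metric.diam_ball (half_pos hδ).le).trans (by linarith)
  · obtain ⟨y, hy⟩ := Set.mem_iUnion.1 (hcov hx)
    obtain ⟨hyt, hyx⟩ := Set.mem_iUnion.1 hy
    exact Set.mem_iUnion.2 ⟨Fintype.equivFin t ⟨y, hyt⟩, by simpa using hyx⟩

theorem coverNumber_anti {δ δ' : ℝ} (hδ : 0 < δ) (h : δ ≤ δ') {X : Set M}
    (hX : TotallyBounded X) : coverNumber δ' X ≤ coverNumber δ X := by
  obtain ⟨U, hU, hcov⟩ := exists_cover hδ hX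
  simpa using coverNumber_le_card U (fun j => ⟨(hU j).1, (hU j).2.trans h⟩) hcov

/-- Multiplicative constants contribute `log C / (-log δ) → 0`. -/
theorem hasBoxDim_of_eventually_le {X : Set M} (hne : X.Nonempty) (hX : TotallyBounded X)
    {D C₁ C₂ : ℝ} (hC₁ : 0 < C₁) (hC₂ : 0 < C₂)
    (h₁ : ∀ᶠ δ : ℝ in 𝓝[>] 0, C₁ * δ ^ (-D) ≤ coverNumber δ X)
    (h₂ : ∀ᶠ δ : ℝ in 𝓝[>] 0, (coverNumber δ X : ℝ) ≤ C₂ * δ ^ (-D)) : HasBoxDim X D := by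
  have hlog : Tendsto (fun δ : ℝ => -Real.log δ) (𝓝[>] 0) atTop :=
    tendsto_neg_atBot_atTop.comp Real.tendsto_log_nhdsGT_zero
  have hlim : ∀ C : ℝ, Tendsto (fun δ : ℝ => D + Real.log C / -Real.log δ) (𝓝[>] 0) (𝓝 D) := by
    intro C
    simpa using (tendsto_const_nhds (x := D)).add (hlog.const_div_atTop (Real.log C))
  have hpos : ∀ᶠ δ : ℝ in 𝓝[>] 0, 0 < δ := eventually_mem_nhdsWithin
  have hid : ∀ {C δ : ℝ}, 0 < C → 0 < δ → 0 < -Real.log δ →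
      Real.log (C * δ ^ (-D)) / -Real.log δ = D + Real.log C / -Real.log δ := by
    intro C δ hC hδ hl
    rw [Real.log_mul hC.ne' (Real.rpow_pos_of_pos hδ _).ne', Real.log_rpow hδ]
    have : Real.log δ ≠ 0 := by linarith [hl] |> fun h : Real.log δ < 0 => h.ne
    field_simp
    ring
  have ht : Tendsto (fun δ : ℝ => Real.log (coverNumber δ X) / -Real.log δ) (𝓝[>] 0) (𝓝 D) := by
    refine tendsto_of_tendsto_of_tendsto_of_le_of_le' (hlim C₁) (hlim C₂) ?_ ?_
    · filter_upwards [h₁, hpos, hlog.eventually_gt_atTop 0] with δ h hδ hl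
      rw [← hid hC₁ hδ hl]
      have := mul_pos hC₁ (Real.rpow_pos_of_pos hδ (-D))
      gcongr
    · filter_upwards [h₁, h₂, hpos, hlog.eventually_gt_atTop 0] with δ h h' hδ hl
      rw [← hid hC₂ hδ hl]
      have := (mul_pos hC₁ (Real.rpow_pos_of_pos hδ (-D))).trans_le h
      gcongr
  have ht' := (continuous_coe_real_ereal.tendsto D).comp ht
  exact ⟨hne, hX, ht'.liminf_eq, ht'.limsup_eq⟩

/-- A lower bound for the covering numbers along a geometric sequence of scales gives one at all
scales. -/
theorem eventually_le_coverNumber_of_geometric {X : Set M} (hX : TotallyBounded X)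
    {D A r θ : ℝ} (hD : 0 ≤ D) (hA : 0 < A) (hr : 0 < r) (hθ : 1 < θ)
    (h : ∀ᶠ N : ℕ in atTop, A * (r / θ ^ N) ^ (-D) ≤ coverNumber (r / θ ^ N) X) :
    ∃ C > 0, ∀ᶠ δ : ℝ in 𝓝[>] 0, C * δ ^ (-D) ≤ coverNumber δ X := by
  have hθ0 : 0 < θ := by linarith
  obtain ⟨N₀, hN₀⟩ := eventually_atTop.1 h
  refine ⟨A * θ ^ (-D), mul_pos hA (Real.rpow_pos_of_pos hθ0 _), ?_⟩
  filter_upwards [Ioo_mem_nhdsGT (show 0 < r / θ ^ N₀ by positivity)] with δ hδ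
  obtain ⟨hδ0, hδ1⟩ := hδ
  rw [lt_div_iff₀ (by positivity)] at hδ1
  have h1 : 1 ≤ r / δ := by
    rw [le_div_iff₀ hδ0, one_mul]
    have : δ * 1 ≤ δ * θ ^ N₀ := by
      gcongr
      exact one_le_pow₀ hθ.le
    linarith
  -- The scale `r / θ^n` lies between `δ` and `θ δ`; this accounts for the loss of `θ^(-D)` in the
  -- constant.
  obtain ⟨n, hn1, hn2⟩ := exists_nat_pow_near h1 hθ
  rw [le_div_iff₀ hδ0] at hn1
  rw [div_lt_iff₀ hδ0] at hn2
  have hn : N₀ ≤ n := by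
    have h2 : θ ^ N₀ < θ ^ (n + 1) := by
      have : δ * θ ^ N₀ < δ * θ ^ (n + 1) := by linarith
      exact lt_of_mul_lt_mul_left this hδ0.le
    have := (pow_lt_pow_iff_right₀ hθ).1 h2
    omega
  have hδn : δ ≤ r / θ ^ n := by
    rw [le_div_iff₀ (by positivity)]
    linarith
  have hδn' : r / θ ^ n ≤ θ * δ := by
    rw [div_le_iff₀ (by positivity)]
    rw [pow_succ] at hn2
    linarith
  calc A * θ ^ (-D) * δ ^ (-D) = A * (θ * δ) ^ (-D) := by
        rw [Real.mul_rpow hθ0.le hδ0.le, mul_assoc]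
    _ ≤ A * (r / θ ^ n) ^ (-D) := by
        have := Real.rpow_le_rpow_of_nonpos (by positivity) hδn' (neg_nonpos.2 hD)
        gcongr
    _ ≤ coverNumber (r / θ ^ n) X := hN₀ n hn
    _ ≤ coverNumber δ X := by exact_mod_cast coverNumber_anti hδ0 hδn hX

end Cover

/-! ### Graphs -/

section Graph

variable {f : ℝ → ℝ}

theorem totallyBounded_graphOver (hf : Continuous f) (c d : ℝ) :
    TotallyBounded (graphOver f c d) := by
  refine IsCompact.totallyBounded (isCompact_Icc.image ?_)
  refine (PiLp.continuous_toLp 2 _).comp (continuous_pi fun j => ?_)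
  fin_cases j
  · exact continuous_id
  · exact hf

theorem nonempty_graphOver (f : ℝ → ℝ) {c d : ℝ} (hcd : c ≤ d) : (graphOver f c d).Nonempty :=
  (Set.nonempty_Icc.2 hcd).image _

theorem abs_coord_sub_le_dist (p p' : EuclideanSpace ℝ (Fin 2)) (j : Fin 2) :
    |p j - p' j| ≤ dist p p' := by
  rw [dist_eq_norm]
  simpa using PiLp.norm_apply_le (p - p') j

theorem dist_le_abs_coord_add (p p' : EuclideanSpace ℝ (Fin 2)) :
    dist p p' ≤ |p 0 - p' 0| + |p 1 - p' 1| := by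
  rw [EuclideanSpace.dist_eq, Fin.sum_univ_two, Real.dist_eq, Real.dist_eq]
  refine Real.sqrt_le_iff.2 ⟨by positivity, ?_⟩
  have := mul_nonneg (abs_nonneg (p 0 - p' 0)) (abs_nonneg (p 1 - p' 1))
  nlinarith

/-- The graph of a Hölder function of exponent `β` has covering numbers `O(δ^(β - 2))`. -/
theorem coverNumber_graphOver_le {C β c d : ℝ} (hβ : β ≤ 1) (hC : 0 ≤ C) (hcd : c ≤ d)
    (hf : ∀ t ∈ Set.Icc c d, ∀ t' ∈ Set.Icc c d, |f t - f t'| ≤ C * |t - t'| ^ β) (hβ0 : 0 < β) :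
    ∃ K > 0, ∀ᶠ δ : ℝ in 𝓝[>] 0, (coverNumber δ (graphOver f c d) : ℝ) ≤ K * δ ^ (-(2 - β)) := by
  refine ⟨4 * ((d - c) + 1) * (2 * C + 1), by have := sub_nonneg.2 hcd; positivity, ?_⟩
  filter_upwards [Ioo_mem_nhdsGT (show (0 : ℝ) < 1 by norm_num)] with δ hδ
  obtain ⟨hδ0, hδ1⟩ := hδ
  have hr : 0 < δ / 2 := half_pos hδ0
  set r := δ / 2 with hrdef
  set h := C * r ^ β with hh
  have hh0 : 0 ≤ h := mul_nonneg hC (Real.rpow_nonneg hr.le _)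
  -- There are `n₁` columns of width `r`. In each of them the graph stays within `h` of its value at
  -- the left end, so `n₂` squares of side `r = δ / 2` suffice.
  set n₁ := ⌊(d - c) / r⌋₊ + 1 with hn₁
  set n₂ := ⌊2 * h / r⌋₊ + 1 with hn₂
  let U : Fin n₁ × Fin n₂ → Set (EuclideanSpace ℝ (Fin 2)) := fun z =>
    {p | p 0 ∈ Set.Icc (c + z.1 * r) (c + z.1 * r + r) ∧
      p 1 ∈ Set.Icc (f (c + z.1 * r) - h + z.2 * r) (f (c + z.1 * r) - h + z.2 * r + r)}
  have hdist : ∀ z, ∀ p ∈ U z, ∀ p' ∈ U z, dist p p' ≤ δ := by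
    rintro z p ⟨h0, h1⟩ p' ⟨h0', h1'⟩
    have e0 : |p 0 - p' 0| ≤ r := abs_le.2 ⟨by linarith [h0.1, h0'.2], by linarith [h0.2, h0'.1]⟩
    have e1 : |p 1 - p' 1| ≤ r := abs_le.2 ⟨by linarith [h1.1, h1'.2], by linarith [h1.2, h1'.1]⟩
    have := dist_le_abs_coord_add p p'
    linarith
  have hcov : graphOver f c d ⊆ ⋃ z, U z := by
    rintro _ ⟨t, ht, rfl⟩
    have ht0 : 0 ≤ (t - c) / r := div_nonneg (by linarith [ht.1]) hr.le
    have hj : ⌊(t - c) / r⌋₊ < n₁ := by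
      rw [hn₁, Nat.lt_succ_iff]
      refine Nat.floor_mono ?_
      have := ht.2
      gcongr
    set j := ⌊(t - c) / r⌋₊ with hjdef
    have hj1 : (j : ℝ) * r ≤ t - c := (le_div_iff₀ hr).1 (Nat.floor_le ht0)
    have hj2 : t - c < (j + 1) * r := (div_lt_iff₀ hr).1 (Nat.lt_floor_add_one _)
    have hmem : c + j * r ∈ Set.Icc c d :=
      ⟨by linarith [mul_nonneg (Nat.cast_nonneg (α := ℝ) j) hr.le], by linarith [ht.2]⟩
    have hft : |f t - f (c + j * r)| ≤ h := by
      refine (hf t ht _ hmem).trans ?_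
      rw [hh]
      have : |t - (c + j * r)| ≤ r := abs_le.2 ⟨by linarith, by linarith⟩
      gcongr
    obtain ⟨hft1, hft2⟩ := abs_le.1 hft
    have hv0 : 0 ≤ (f t - f (c + j * r) + h) / r := div_nonneg (by linarith) hr.le
    have hm : ⌊(f t - f (c + j * r) + h) / r⌋₊ < n₂ := by
      rw [hn₂, Nat.lt_succ_iff]
      refine Nat.floor_mono ?_
      gcongr
      linarith
    set m := ⌊(f t - f (c + j * r) + h) / r⌋₊ with hmdef
    have hm1 : (m : ℝ) * r ≤ f t - f (c + j * r) + h := (le_div_iff₀ hr).1 (Nat.floor_le hv0)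
    have hm2 : f t - f (c + j * r) + h < (m + 1) * r :=
      (div_lt_iff₀ hr).1 (Nat.lt_floor_add_one _)
    refine Set.mem_iUnion.2 ⟨(⟨j, hj⟩, ⟨m, hm⟩), ?_⟩
    simp only [U, Set.mem_ofPred_eq, Set.mem_Icc, Matrix.cons_val_zero,
      Matrix.cons_val_one]
    refine ⟨⟨by linarith, by linarith⟩, ⟨by linarith, by linarith⟩⟩
  have hle := coverNumber_le_card U (fun z => ⟨Metric.isBounded_iff.2 ⟨δ, fun p hp p' hp' =>
    hdist z p hp p' hp'⟩, Metric.diam_le_of_forall_dist_le hδ0.le (hdist z)⟩) hcov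
  rw [Fintype.card_prod, Fintype.card_fin, Fintype.card_fin] at hle
  have hle' : (coverNumber δ (graphOver f c d) : ℝ) ≤ (n₁ : ℝ) * n₂ := by exact_mod_cast hle
  refine hle'.trans ?_
  have hr1 : r ≤ 1 := by linarith
  have b1 : (n₁ : ℝ) ≤ (d - c + 1) * r⁻¹ := by
    have h1 : (n₁ : ℝ) ≤ (d - c) / r + 1 := by
      rw [hn₁]
      push_cast
      have := Nat.floor_le (div_nonneg (sub_nonneg.2 hcd) hr.le)
      linarith
    have h2 : 1 ≤ r⁻¹ := (one_le_inv₀ hr).2 hr1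
    rw [div_eq_mul_inv] at h1
    linarith
  have b2 : (n₂ : ℝ) ≤ (2 * C + 1) * r ^ (β - 1) := by
    have h1 : (n₂ : ℝ) ≤ 2 * h / r + 1 := by
      rw [hn₂]
      push_cast
      have := Nat.floor_le (div_nonneg (mul_nonneg zero_le_two hh0) hr.le)
      linarith
    have h2 : 1 ≤ r ^ (β - 1) := Real.one_le_rpow_of_pos_of_le_one_of_nonpos hr hr1 (by linarith)
    have h3 : 2 * h / r = 2 * C * r ^ (β - 1) := by
      rw [hh, Real.rpow_sub_one hr.ne']
      ring
    rw [h3] at h1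
    linarith
  have b3 : r⁻¹ * r ^ (β - 1) = 2 ^ (2 - β) * δ ^ (-(2 - β)) := by
    have h1 : r⁻¹ = r ^ (-1 : ℝ) := by rw [Real.rpow_neg_one]
    have h2 : (2 : ℝ) ^ (2 - β) = 2⁻¹ ^ (-(2 - β)) := by
      rw [Real.inv_rpow zero_le_two, Real.rpow_neg zero_le_two, inv_inv]
    rw [h1, ← Real.rpow_add hr, h2, ← Real.mul_rpow (by norm_num) hδ0.le, hrdef]
    congr 1
    · ring
    · ring
  have b4 : (2 : ℝ) ^ (2 - β) ≤ 4 := by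
    have : (2 : ℝ) ^ (2 - β) ≤ 2 ^ (2 : ℝ) :=
      Real.rpow_le_rpow_of_exponent_le one_le_two (by linarith)
    norm_num at this ⊢
    exact this
  have hdc := sub_nonneg.2 hcd
  have hδp := Real.rpow_nonneg hδ0.le (-(2 - β))
  calc (n₁ : ℝ) * n₂ ≤ ((d - c + 1) * r⁻¹) * ((2 * C + 1) * r ^ (β - 1)) := by
        gcongr
    _ = (d - c + 1) * (2 * C + 1) * (r⁻¹ * r ^ (β - 1)) := by ring
    _ = (d - c + 1) * (2 * C + 1) * (2 ^ (2 - β) * δ ^ (-(2 - β))) := by rw [b3]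
    _ ≤ (d - c + 1) * (2 * C + 1) * (4 * δ ^ (-(2 - β))) := by gcongr
    _ = _ := by ring

theorem exists_points_cover {δ : ℝ} (hδ : 0 < δ) (hf : Continuous f) (c d : ℝ) :
    ∃ P : Fin (coverNumber δ (graphOver f c d)) → ℝ × ℝ, ∀ t ∈ Set.Icc c d,
      ∃ j, |t - (P j).1| ≤ δ ∧ |f t - (P j).2| ≤ δ := by
  classical
  obtain ⟨U, hU, hcov⟩ := exists_cover hδ (totallyBounded_graphOver hf c d)
  -- Each covering set is replaced by one of its points; empty sets get a dummy.
  refine ⟨fun j => if h : (U j).Nonempty then (h.some 0, h.some 1) else 0, fun t ht => ?_⟩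
  obtain ⟨j, hj⟩ := Set.mem_iUnion.1 (hcov ⟨t, ht, rfl⟩)
  have hne : (U j).Nonempty := ⟨_, hj⟩
  have hd := (Metric.dist_le_diam_of_mem (hU j).1 hj hne.some_mem).trans (hU j).2
  refine ⟨j, ?_⟩
  simp only [dif_pos hne]
  exact ⟨by simpa using (abs_coord_sub_le_dist _ _ 0).trans hd,
    by simpa using (abs_coord_sub_le_dist _ _ 1).trans hd⟩

open MeasureTheory in
-- Projecting the cover to the first axis gives intervals of length `2δ` that cover `[c, d]`.
theorem sub_le_coverNumber_graphOver {δ c d : ℝ} (hδ : 0 < δ) (hf : Continuous f) (hcd : c ≤ d) :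
    d - c ≤ coverNumber δ (graphOver f c d) * (2 * δ) := by
  obtain ⟨P, hP⟩ := exists_points_cover hδ hf c d
  have hsub : Set.Icc c d ⊆ ⋃ j ∈ Finset.univ, Set.Icc ((P j).1 - δ) ((P j).1 + δ) := by
    intro t ht
    obtain ⟨j, h1, -⟩ := hP t ht
    obtain ⟨h2, h3⟩ := abs_le.1 h1
    exact Set.mem_biUnion (Finset.mem_univ j) ⟨by linarith, by linarith⟩
  have h1 : volume.real (Set.Icc c d) ≤
      ∑ j, volume.real (Set.Icc ((P j).1 - δ) ((P j).1 + δ)) :=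
    (measureReal_mono hsub (by
      refine (measure_biUnion_lt_top (Finset.finite_toSet _) fun j _ => ?_).ne
      exact measure_Icc_lt_top)).trans (measureReal_biUnion_finset_le _ _)
  rw [Real.volume_real_Icc_of_le hcd] at h1
  refine h1.trans (le_of_eq ?_)
  have : ∀ j, volume.real (Set.Icc ((P j).1 - δ) ((P j).1 + δ)) = 2 * δ := fun j => by
    rw [Real.volume_real_Icc_of_le (by linarith)]
    ring
  simp [this]

open MeasureTheory in
/-- The oscillation of `f` at scale `δ` is bounded by the area of a neighbourhood of its graph. -/
theorem integral_abs_sub_le_coverNumber {δ s c d c' d' : ℝ} (hδ : 0 < δ) (hf : Continuous f)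
    (hs : |s| ≤ δ) (hc : c + δ ≤ c') (hcd : c' ≤ d') (hd : d' + δ ≤ d) :
    ∫ t in c'..d', |f (t + s) - f t| ≤ coverNumber δ (graphOver f c d) * (8 * δ ^ 2) := by
  obtain ⟨P, hP⟩ := exists_points_cover hδ hf c d
  obtain ⟨hs1, hs2⟩ := abs_le.1 hs
  set I : Fin (coverNumber δ (graphOver f c d)) → Set ℝ :=
    fun j => Set.Icc ((P j).1 - 2 * δ) ((P j).1 + 2 * δ) with hI
  have hpt : ∀ t ∈ Set.Icc c' d',
      |f (t + s) - f t| ≤ ∑ j, (I j).indicator (fun _ => 2 * δ) t := by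
    intro t ht
    -- By the intermediate value theorem, every height between `f t` and `f (t + s)` is attained
    -- within `δ` of `t`. Only the `P j` within `2δ` of `t` horizontally are needed, each covering a
    -- height `2δ`; integrating over `t` gives `4δ · 2δ` per set.
    have hsub : Set.uIcc (f t) (f (t + s)) ⊆ ⋃ j ∈ Finset.univ,
        {y | t ∈ I j ∧ y ∈ Set.Icc ((P j).2 - δ) ((P j).2 + δ)} := by
      intro y hy
      obtain ⟨t', ht', rfl⟩ := intermediate_value_uIcc hf.continuousOn hy
      have htt : |t' - t| ≤ δ := by
        refine le_trans ?_ hs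
        simpa using Set.abs_sub_left_of_mem_uIcc ht'
      obtain ⟨h1, h2⟩ := abs_le.1 htt
      obtain ⟨j, h3, h4⟩ := hP t' ⟨by linarith [ht.1], by linarith [ht.2]⟩
      obtain ⟨h5, h6⟩ := abs_le.1 h3
      obtain ⟨h7, h8⟩ := abs_le.1 h4
      exact Set.mem_biUnion (Finset.mem_univ j)
        ⟨⟨by linarith, by linarith⟩, ⟨by linarith, by linarith⟩⟩
    have hbd : ∀ j, volume {y | t ∈ I j ∧ y ∈ Set.Icc ((P j).2 - δ) ((P j).2 + δ)} ≠ ⊤ :=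
      fun j => ((measure_mono fun y hy => hy.2).trans_lt
        (measure_Icc_lt_top (a := (P j).2 - δ) (b := (P j).2 + δ))).ne
    have h1 : volume.real (Set.uIcc (f t) (f (t + s))) ≤
        ∑ j, volume.real {y | t ∈ I j ∧ y ∈ Set.Icc ((P j).2 - δ) ((P j).2 + δ)} :=
      (measureReal_mono hsub (measure_biUnion_lt_top (Finset.finite_toSet _)
        fun j _ => (hbd j).lt_top).ne).trans (measureReal_biUnion_finset_le _ _)
    have h2 : volume.real (Set.uIcc (f t) (f (t + s))) = |f (t + s) - f t| :=
      Real.volume_real_interval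
    rw [h2] at h1
    refine h1.trans (Finset.sum_le_sum fun j _ => ?_)
    by_cases hj : t ∈ I j
    · rw [Set.indicator_of_mem hj]
      simp only [hj, true_and, Set.ofPred_mem_eq]
      rw [Real.volume_real_Icc_of_le (by linarith)]
      linarith
    · rw [Set.indicator_of_notMem hj]
      simp [hj]
  have hind : ∀ j, IntervalIntegrable ((I j).indicator fun _ => 2 * δ) volume c' d' := fun j =>
    (intervalIntegrable_iff.2 ((integrableOn_const (by simp)).indicator measurableSet_Icc))
  have h3 : ∫ t in c'..d', |f (t + s) - f t| ≤
      ∫ t in c'..d', ∑ j, (I j).indicator (fun _ => 2 * δ) t :=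
    intervalIntegral.integral_mono_on hcd (Continuous.intervalIntegrable (by fun_prop) _ _)
      (by simpa only [Finset.sum_fn] using IntervalIntegrable.sum Finset.univ fun j _ => hind j) hpt
  rw [intervalIntegral.integral_finsetSum fun j _ => hind j] at h3
  refine h3.trans ?_
  have h4 : ∀ j, ∫ t in c'..d', (I j).indicator (fun _ => 2 * δ) t ≤ 8 * δ ^ 2 := by
    intro j
    rw [intervalIntegral.integral_of_le hcd]
    calc ∫ t in Set.Ioc c' d', (I j).indicator (fun _ => 2 * δ) t
        ≤ ∫ t, (I j).indicator (fun _ => 2 * δ) t := by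
          refine setIntegral_le_integral ?_ (.of_forall fun t => ?_)
          · exact (integrableOn_const (by simp [hI])).integrable_indicator measurableSet_Icc
          · exact Set.indicator_nonneg (fun _ _ => by positivity) t
      _ = 8 * δ ^ 2 := by
          rw [integral_indicator measurableSet_Icc, setIntegral_const,
            Real.volume_real_Icc_of_le (by linarith), smul_eq_mul]
          ring
  calc _ ≤ ∑ _j : Fin (coverNumber δ (graphOver f c d)), 8 * δ ^ 2 :=
        Finset.sum_le_sum fun j _ => h4 j
    _ = _ := by simp

/-- The upper bound is the Hölder estimate with exponent `1`, the lower bound the projection to the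
first axis. -/
theorem hasBoxDim_graphOver_of_contDiff (hf : ContDiff ℝ 1 f) {c d : ℝ} (hcd : c < d) :
    HasBoxDim (graphOver f c d) 1 := by
  obtain ⟨K, hK⟩ := (hf.locallyLipschitz.locallyLipschitzOn (s := Set.Icc c d)
    ).exists_lipschitzOnWith_of_compact isCompact_Icc
  obtain ⟨C, hC, hup⟩ := coverNumber_graphOver_le (f := f) (C := K) (β := 1) le_rfl
    K.coe_nonneg hcd.le (fun t ht t' ht' => by
      simpa [Real.dist_eq] using hK.dist_le_mul t ht t' ht') one_pos
  have hdc := sub_pos.2 hcd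
  have e : (-(2 - 1) : ℝ) = -1 := by norm_num
  rw [e] at hup
  refine hasBoxDim_of_eventually_le (C₁ := (d - c) / 2) (nonempty_graphOver f hcd.le)
    (totallyBounded_graphOver hf.continuous c d) (by positivity) hC ?_ hup
  filter_upwards [self_mem_nhdsWithin] with δ hδ
  rw [Real.rpow_neg_one, ← div_eq_mul_inv, div_le_iff₀ hδ]
  linarith [sub_le_coverNumber_graphOver hδ hf.continuous hcd.le]

end Graph

end SkewGraph

/-! ### The dichotomy -/

namespace LacunaryData

open SkewGraph

variable {lam b α : ℝ} {q : ℝ → ℝ} (h : LacunaryData lam b α q (fourierCoeffAP q))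
include h

/-- Hölder continuity bounds the covering numbers above. Below, an integrated oscillation of order
`δ^α` is compared with the area bound `8δ² N_δ` at the scales `δ = |s||b|^(-N)`. -/
theorem hasBoxDim_graphOver (hq : ContDiff ℝ 1 q) {σ : ℝ} (hσ : σ ≠ 0)
    (hg : gCoeff lam b q σ ≠ 0) {c d : ℝ} (hcd : c < d) :
    HasBoxDim (graphOver (lacunarySum lam b q) c d) (2 - α) := by
  have hcont := h.continuous_lacunarySum
  have htb := totallyBounded_graphOver hcont c d
  obtain ⟨C, hC, hhol⟩ := h.exists_lacunarySum_holder
  obtain ⟨K, hK, hup⟩ := coverNumber_graphOver_le (f := lacunarySum lam b q)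
    h.exponent_lt_one.le hC.le hcd.le (fun t _ t' _ => by simpa using hhol (t - t') t')
    h.exponent_pos
  -- The oscillation is measured on the middle third, leaving a margin larger than `δ` on both
  -- sides.
  set w := (d - c) / 3 with hw
  have hw0 : 0 < w := div_pos (sub_pos.2 hcd) three_pos
  obtain ⟨s, hs, A, hA, hlow⟩ := h.exists_integral_abs_lacunarySum_ge hq hσ hg
    (show c + w < d - w by linarith)
  have hs0 : 0 < |s| := abs_pos.2 hs
  have hb0 : 0 < |b| := one_pos.trans h.one_lt_abs
  have hscale : Tendsto (fun N : ℕ => |s| / |b| ^ N) atTop (𝓝 0) :=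
    (tendsto_pow_atTop_atTop_of_one_lt h.one_lt_abs).const_div_atTop |s|
  have hgeo : ∀ᶠ N : ℕ in atTop, A / (8 * |s| ^ α) * (|s| / |b| ^ N) ^ (-(2 - α)) ≤
      coverNumber (|s| / |b| ^ N) (graphOver (lacunarySum lam b q) c d) := by
    filter_upwards [hlow, hscale.eventually (gt_mem_nhds hw0)] with N hN hNw
    have hδ : 0 < |s| / |b| ^ N := by positivity
    have hsN : |b ^ (-(N : ℤ)) * s| = |s| / |b| ^ N := by
      rw [abs_mul, abs_zpow, zpow_neg, zpow_natCast, div_eq_inv_mul]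
    have hlamN : lam ^ N = (|s| / |b| ^ N) ^ α / |s| ^ α := by
      have := h.lam_zpow_eq N
      rw [zpow_natCast, zpow_neg, zpow_natCast] at this
      rw [this, ← Real.div_rpow hδ.le hs0.le]
      congr 1
      field_simp
    have h1 := hN.trans (integral_abs_sub_le_coverNumber (c := c) (d := d) hδ hcont hsN.le
      (by linarith) (by linarith) (by linarith))
    generalize |s| / |b| ^ N = δ at *
    rw [hlamN] at h1
    have h2 : δ ^ (-(2 - α)) = δ ^ α / δ ^ 2 := by
      rw [neg_sub, Real.rpow_sub hδ, Real.rpow_two]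
    rw [h2]
    have h3 : 0 < |s| ^ α := Real.rpow_pos_of_pos hs0 α
    calc A / (8 * |s| ^ α) * (δ ^ α / δ ^ 2) = A * (δ ^ α / |s| ^ α) / (8 * δ ^ 2) := by
          field_simp
      _ ≤ _ := (div_le_iff₀ (by positivity)).2 h1
  have hα := h.exponent_lt_one
  obtain ⟨C₁, hC₁, hlo⟩ := eventually_le_coverNumber_of_geometric htb (by linarith)
    (div_pos hA (mul_pos (by norm_num) (Real.rpow_pos_of_pos hs0 α))) hs0 h.one_lt_abs hgeo
  exact hasBoxDim_of_eventually_le (nonempty_graphOver _ hcd.le) htb hC₁ hK hlo hup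

end LacunaryData

namespace SkewGraph

/-! ### The skew product -/

section Toral

variable {k : ℕ}

theorem toralMap_add (A : Matrix (Fin k) (Fin k) ℤ) (x y : Torus k) :
    toralMap A (x + y) = toralMap A x + toralMap A y := by
  ext j
  simp [toralMap, Finset.sum_add_distrib]

theorem toralMap_one (x : Torus k) : toralMap 1 x = x := by
  ext j
  simp [toralMap, Matrix.one_apply, ite_smul]

theorem toralMap_mul (A A' : Matrix (Fin k) (Fin k) ℤ) (x : Torus k) :
    toralMap (A * A') x = toralMap A (toralMap A' x) := by
  ext j
  simp only [toralMap, Matrix.mul_apply, Finset.sum_smul, Finset.smul_sum, mul_smul]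
  exact Finset.sum_comm

theorem toralMap_toTorus (A : Matrix (Fin k) (Fin k) ℤ) (y : Fin k → ℝ) :
    toralMap A (toTorus y) = toTorus ((A.map (Int.cast : ℤ → ℝ)).mulVec y) := by
  ext j
  simp only [toralMap, toTorus, Matrix.mulVec, dotProduct, Matrix.map_apply]
  have : ((∑ l, (A j l : ℝ) * y l : ℝ) : UnitAddCircle) =
      ∑ l, (((A j l : ℝ) * y l : ℝ) : UnitAddCircle) :=
    map_sum (QuotientAddGroup.mk' (AddSubgroup.zmultiples (1 : ℝ))) _ _
  rw [this]
  refine Finset.sum_congr rfl fun l _ => ?_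
  rw [← zsmul_eq_mul, AddCircle.coe_zsmul]

variable {A : Matrix (Fin k) (Fin k) ℤ} {B : Fin k → ℝ}
  {v : Module.Basis (Fin k) ℝ (Fin k → ℝ)}

theorem IsLinearAnosov.eigenvalue_ne_zero (hA : IsLinearAnosov A B v) (i : Fin k) : B i ≠ 0 := by
  intro h0
  have h1 := hA.eigen i
  rw [h0, zero_smul] at h1
  have hdet : (A.map (Int.cast : ℤ → ℝ)).det ≠ 0 := by
    have h2 : (A.map (Int.cast : ℤ → ℝ)).det = (A.det : ℝ) :=
      ((Int.castRingHom ℝ).map_det A).symm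
    rw [h2]
    exact_mod_cast hA.isUnit_det.ne_zero
  exact v.ne_zero i (Matrix.eq_zero_of_mulVec_eq_zero hdet h1)

/-- The line through a fixed point in the direction of an eigenvector is invariant. -/
theorem IsLinearAnosov.toralMap_inv_pow (hA : IsLinearAnosov A B v) (i : Fin k) {x : Torus k}
    (hx : toralMap A x = x) (n : ℕ) (t : ℝ) :
    toralMap (A⁻¹ ^ n) (toTorus (t • v i) + x) = toTorus (((B i)⁻¹ ^ n * t) • v i) + x := by
  have hB := hA.eigenvalue_ne_zero i
  have hstep : ∀ t : ℝ,
      toralMap A⁻¹ (toTorus (t • v i) + x) = toTorus (((B i)⁻¹ * t) • v i) + x := by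
    intro t
    have h1 : toralMap A (toTorus (((B i)⁻¹ * t) • v i) + x) = toTorus (t • v i) + x := by
      rw [toralMap_add, hx, toralMap_toTorus, Matrix.mulVec_smul, hA.eigen, smul_smul,
        mul_right_comm, inv_mul_cancel₀ hB, one_mul]
    rw [← h1, ← toralMap_mul, Matrix.nonsing_inv_mul A hA.isUnit_det, toralMap_one]
  induction n with
  | zero => simp [toralMap_one]
  | succ n ih =>
    rw [pow_succ', toralMap_mul, ih, hstep, ← mul_assoc, ← pow_succ']

theorem IsLinearAnosov.lacunarySum_eq_alongLine (hA : IsLinearAnosov A B v) (lam : ℝ)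
    (p : Torus k → ℝ) (i : Fin k) {x : Torus k} (hx : toralMap A x = x) :
    lacunarySum lam (B i)⁻¹ (alongLine p (v i) x) = alongLine (phi A lam p) (v i) x := by
  ext t
  simp only [lacunarySum, alongLine, phi, phiTerm, hA.toralMap_inv_pow i hx]

end Toral

/-- Both logarithms are negative and `log |β| < log lam`, whence `0 < α < 1`. The exponent in
`HypH1` for the base `β⁻¹` is the same `α`, as the two signs cancel. -/
theorem lacunaryData {lam β : ℝ} {q : ℝ → ℝ} (hlam0 : 0 < lam) (hlam1 : lam < 1) (hβ : β ≠ 0)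
    (hβlam : |β| < lam) (hq : Continuous q) (hap : IsAlmostPeriodic q)
    (hH1 : HypH1 lam β⁻¹ q) :
    LacunaryData lam β⁻¹ (Real.log lam / Real.log |β|) q (fourierCoeffAP q) := by
  have hβ0 : 0 < |β| := abs_pos.2 hβ
  have hl1 : Real.log lam < 0 := Real.log_neg hlam0 hlam1
  have hl2 : Real.log |β| < Real.log lam := Real.log_lt_log hβ0 hβlam
  have hl3 : Real.log |β| ≠ 0 := by linarith [hl2] |> fun h : Real.log |β| < 0 => h.ne
  have hqap := hap.isNormalAP hq
  refine ⟨hlam0, hlam1, ?_, div_pos_of_neg_of_neg hl1 (hl2.trans hl1), ?_, ?_, hqap,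
    fun a => ?_, ?_⟩
  · rw [abs_inv]
    exact (one_lt_inv₀ hβ0).2 (hβlam.trans hlam1)
  · rw [div_lt_one_of_neg (hl2.trans hl1)]
    exact hl2
  · rw [abs_inv, Real.inv_rpow hβ0.le, Real.rpow_def_of_pos hβ0, mul_div_cancel₀ _ hl3,
      Real.exp_log hlam0, mul_inv_cancel₀ hlam0.ne']
  · obtain ⟨c, hc⟩ := hqap.exists_hasCoeff a
    rwa [fourierCoeffAP, hc.tendsto_fourierMean.limUnder_eq]
  · rw [HypH1, abs_inv, Real.log_inv, neg_div_neg_eq] at hH1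
    exact hH1

end SkewGraph

theorem mainTheorem4 {k : ℕ} (A : Matrix (Fin k) (Fin k) ℤ) (B : Fin k → ℝ)
    (v : Module.Basis (Fin k) ℝ (Fin k → ℝ)) (hA : SkewGraph.IsLinearAnosov A B v)
    (lam : ℝ) (hlam0 : 0 < lam) (hlam1 : lam < 1)
    (p : SkewGraph.Torus k → ℝ) (x : SkewGraph.Torus k)
    (i : Fin k) (hi : |B i| < lam)
    (q : ℝ → ℝ) (hq : q = SkewGraph.alongLine p (v i) x)
    (φ : ℝ → ℝ) (hφ : φ = SkewGraph.lacunarySum lam (B i)⁻¹ q)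
    (hC1 : ContDiff ℝ 1 q) (hap : SkewGraph.IsAlmostPeriodic q)
    (hH1 : SkewGraph.HypH1 lam (B i)⁻¹ q) :
    -- the Fourier coefficients of `q`, the function `φ` and the Fourier coefficients of `g`
    -- are well defined
    (∀ a : ℝ, Filter.Tendsto (SkewGraph.fourierMean q a) Filter.atTop
      (nhds (SkewGraph.fourierCoeffAP q a))) ∧
    (∀ t : ℝ, Summable (fun n : ℕ => lam ^ n * q ((B i)⁻¹ ^ n * t))) ∧
    (∀ σ : ℝ, σ ≠ 0 → Summable (SkewGraph.gCoeffTerm lam (B i)⁻¹ q σ)) ∧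
    -- through a fixed point `x` of the base map, `φ` is the sub-slice of the invariant graph
    (SkewGraph.toralMap A x = x →
      φ = SkewGraph.alongLine (SkewGraph.phi A lam p) (v i) x) ∧
    -- the dichotomy
    (((∀ σ : ℝ, σ ≠ 0 → SkewGraph.gCoeff lam (B i)⁻¹ q σ = 0) ∧ ContDiff ℝ 1 φ ∧
        ∀ c d : ℝ, c < d → SkewGraph.HasBoxDim (SkewGraph.graphOver φ c d) 1) ∨
      ((∃ σ : ℝ, σ ≠ 0 ∧ SkewGraph.gCoeff lam (B i)⁻¹ q σ ≠ 0) ∧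
        ∀ c d : ℝ, c < d → SkewGraph.HasBoxDim (SkewGraph.graphOver φ c d)
          (2 - Real.log lam / Real.log |B i|))) := by
  have h := SkewGraph.lacunaryData hlam0 hlam1 (hA.eigenvalue_ne_zero i) hi hC1.continuous hap hH1
  obtain ⟨C, hC⟩ := h.exists_bound
  subst hφ
  refine ⟨fun a => (h.hasCoeff a).tendsto_fourierMean, summable_lacunary hlam0 hlam1 hC,
    fun σ hσ => h.summable_gCoeffTerm hσ, fun hx => ?_, ?_⟩
  · rw [hq]
    exact hA.lacunarySum_eq_alongLine lam p i hx
  · by_cases hg : ∀ σ : ℝ, σ ≠ 0 → SkewGraph.gCoeff lam (B i)⁻¹ q σ = 0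
    · have hsmooth := h.contDiff_lacunarySum hC1 hg
      exact Or.inl ⟨hg, hsmooth, fun c d hcd => SkewGraph.hasBoxDim_graphOver_of_contDiff hsmooth hcd⟩
    · push Not at hg
      obtain ⟨σ, hσ, hgσ⟩ := hg
      exact Or.inr ⟨⟨σ, hσ, hgσ⟩, fun c d hcd => h.hasBoxDim_graphOver hC1 hσ hgσ hcd⟩
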